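/- Let $\nu\in\{1,-1\}$ and $\gamma>0$, and let $\mathcal{L}=\nu I+\gamma\mathcal{B}$, where $\mathcal{B}$ is the operator on $L^2(\mathbb{R}^2)$ with $\widehat{\mathcal{B}f}(\xi)=\frac{\xi_1^2}{\xi_1^2+\xi_2^2}\hat f(\xi)$. Let $C_{opt}$ denote the optimal (smallest) constant $C$ in the inequality $$\int_{\mathbb{R}^2}\mathcal{L}(|u|^2)\,|u|^2\,dx\le C\,\|\nabla u\|_2^2\,\|u\|_2^2\qquad\text{for all complex-valued }u\in H^1(\mathbb{R}^2).$$ Let $0<m,M<\infty$ and let $\{v_n\}_{n=1}^\infty$ be a bounded sequence in $H^1(\mathbb{R}^2)$ such that $$\limsup_{n\to\infty}\|\nabla v_n\|_2^2\le M^2,\qquad \limsup_{n\to\infty}\int_{\mathbb{R}^2}\mathcal{L}(|v_n|^2)\,|v_n|^2\,dx\ge m^4 .$$ Then the optimal constant $C_{opt}$ exists and is positive, and there are a sequence $\{x_n\}\subset\mathbb{R}^2$ and a function $V\in H^1(\mathbb{R}^2)$ such that, along a subsequence, $v_n(\cdot+x_n)\rightharpoonup V$ weakly in $H^1(\mathbb{R}^2)$,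 and $$\|V\|_2\ge\frac{m^2}{M\sqrt{C_{opt}}}.$$ -/

import Mathlib

open MeasureTheory Filter Topology FourierTransform LineDeriv
open scoped ENNReal SchwartzMap

noncomputable section

namespace DaveyStewartson

/-- The plane `ℝ²` with its Euclidean norm. -/
abbrev Plane : Type := EuclideanSpace ℝ (Fin 2)

/-- The Hilbert space `L²(ℝ²; ℂ)`. -/
abbrev L2 : Type := Lp ℂ 2 (volume : Measure Plane)

/-- Pairs `(u, g)` of an `L²` function and an `L²` vector field `g = (g₀, g₁)`, with the Hilbert
norm `(‖u‖₂² + ‖g₀‖₂² + ‖g₁‖₂²)^{1/2}`. -/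
abbrev Pairs : Type := WithLp 2 (L2 × PiLp 2 (fun _ : Fin 2 => L2))

/-- `g` is the weak (distributional) derivative of `u` in the `i`-th coordinate direction. -/
def IsWeakPartial (i : Fin 2) (u g : L2) : Prop :=
  ∂_{(EuclideanSpace.single i (1 : ℝ) : Plane)} (u : 𝓢'(Plane, ℂ)) = (g : 𝓢'(Plane, ℂ))

/-- Unfolded: `∫ φ g = - ∫ (∂ᵢ φ) u` for all test functions `φ`. -/
theorem isWeakPartial_iff (i : Fin 2) (u g : L2) :
    IsWeakPartial i u g ↔ ∀ φ : 𝓢(Plane, ℂ),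
      ∫ x, φ x • g x
        = -∫ x, (∂_{(EuclideanSpace.single i (1 : ℝ) : Plane)} φ : 𝓢(Plane, ℂ)) x • u x := by
  unfold IsWeakPartial
  constructor
  · intro h φ
    have h1 := congrArg (fun T : 𝓢'(Plane, ℂ) => T φ) h
    simp only [TemperedDistribution.lineDerivOp_apply_apply,
      Lp.toTemperedDistribution_apply] at h1
    rw [← h1, ← integral_neg]
    congr 1
    ext x
    simp
  · intro h
    ext φ
    simp only [TemperedDistribution.lineDerivOp_apply_apply, Lp.toTemperedDistribution_apply]
    rw [h φ, ← integral_neg]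
    congr 1
    ext x
    simp

/-- The subspace of those pairs `(u, g)` in which `g` is the weak gradient of `u`. -/
def sobolevSubmodule : Submodule ℂ Pairs where
  carrier := {p | ∀ i, IsWeakPartial i p.fst (p.snd i)}
  zero_mem' := by
    intro i
    unfold IsWeakPartial
    simp only [← Lp.toTemperedDistributionCLM_apply]
    simp only [WithLp.zero_fst, WithLp.zero_snd, PiLp.zero_apply, map_zero, lineDerivOp_zero]
  add_mem' := by
    intro p q hp hq i
    have h1 := hp i
    have h2 := hq i
    unfold IsWeakPartial at h1 h2 ⊢
    simp only [← Lp.toTemperedDistributionCLM_apply] at h1 h2 ⊢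
    simp only [WithLp.add_fst, WithLp.add_snd, PiLp.add_apply, map_add, lineDerivOp_add, h1, h2]
  smul_mem' := by
    intro c p hp i
    have h1 := hp i
    unfold IsWeakPartial at h1 ⊢
    simp only [← Lp.toTemperedDistributionCLM_apply] at h1 ⊢
    simp only [WithLp.smul_fst, WithLp.smul_snd, PiLp.smul_apply, map_smul, lineDerivOp_smul, h1]

/-- The Sobolev space `H¹(ℝ²; ℂ)`: a function `u ∈ L²` together with its weak gradient `g ∈ L²`
(which is determined by `u`). The inherited norm is `(‖u‖₂² + ‖∇u‖₂²)^{1/2}`. -/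
abbrev H1 : Type := sobolevSubmodule

/-- The underlying `L²` function of an element of `H¹`. -/
def toL2 (u : H1) : L2 := (u : Pairs).fst

/-- The weak gradient of an element of `H¹`. -/
def grad (u : H1) : PiLp 2 (fun _ : Fin 2 => L2) := (u : Pairs).snd

/-- The translate `f(· + a)` of `f ∈ L²`. -/
def shift (a : Plane) (f : L2) : L2 :=
  Lp.compMeasurePreserving (fun x => x + a) (measurePreserving_add_right volume a) f

theorem coeFn_shift (a : Plane) (f : L2) : shift a f =ᵐ[volume] fun x => f (x + a) :=
  Lp.coeFn_compMeasurePreserving f (measurePreserving_add_right volume a)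

theorem integral_smul_shift (a : Plane) (f : L2) (φ : Plane → ℂ) :
    ∫ x, φ x • shift a f x = ∫ x, φ (x - a) • f x := by
  rw [← integral_add_right_eq_self (fun x => φ (x - a) • f x) a]
  apply integral_congr_ae
  filter_upwards [coeFn_shift a f] with x hx
  simp [hx]

theorem IsWeakPartial.shift {i : Fin 2} {u g : L2} (h : IsWeakPartial i u g) (a : Plane) :
    IsWeakPartial i (shift a u) (shift a g) := by
  rw [isWeakPartial_iff] at h ⊢
  intro φ
  rw [integral_smul_shift, integral_smul_shift]
  have h1 := h (φ.compSubConstCLM ℂ a)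
  simp only [SchwartzMap.compSubConstCLM_apply] at h1
  rw [h1]
  congr 2
  ext x
  congr 1
  simp only [SchwartzMap.lineDerivOp_apply_eq_fderiv]
  have : (⇑(φ.compSubConstCLM ℂ a) : Plane → ℂ) = fun y => φ (y - a) := rfl
  rw [this, fderiv_comp_sub]

/-- The translate `u(· + a)` of `u ∈ H¹`. -/
def translate (a : Plane) (u : H1) : H1 :=
  ⟨WithLp.toLp 2 (shift a (toL2 u), WithLp.toLp 2 fun i => shift a (grad u i)),
    fun i => (u.2 i).shift a⟩

/-- The symbol `ξ₁² / (ξ₁² + ξ₂²)`. It is homogeneous of degree zero, so that it does not depend on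
the normalization of the Fourier transform; its value at the origin is irrelevant. -/
def symbolB (ξ : Plane) : ℂ := ((ξ 0 ^ 2 / (ξ 0 ^ 2 + ξ 1 ^ 2) : ℝ) : ℂ)

theorem memLp_symbolB : MemLp symbolB ∞ (volume : Measure Plane) := by
  apply memLp_top_of_bound (C := 1)
  · have : Measurable symbolB := by unfold symbolB; fun_prop
    exact this.aestronglyMeasurable
  · refine Eventually.of_forall fun ξ => ?_
    unfold symbolB
    rw [Complex.norm_real, Real.norm_eq_abs, abs_of_nonneg (by positivity)]
    exact div_le_one_of_le₀ (by nlinarith [sq_nonneg (ξ 1)]) (by positivity)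

/-- The operator `𝓑` on `L²`, `(𝓑 f)^(ξ) = ξ₁² / (ξ₁² + ξ₂²) f^(ξ)`. -/
def opB (f : L2) : L2 :=
  𝓕⁻ ((memLp_symbolB.toLp symbolB • (𝓕 f : L2) : L2))

/-- The operator `𝓛 = ν I + γ 𝓑` on `L²`. -/
def opL (ν γ : ℝ) (f : L2) : L2 := (ν : ℂ) • f + (γ : ℂ) • opB f

open Classical in
/-- The function `|u|²` as an element of `L²`. For `u ∈ H¹(ℝ²)` one has `u ∈ L⁴` by the Sobolev
embedding, so that the first case always applies to such `u`. -/
def normSq (u : L2) : L2 :=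
  if h : MemLp (fun x => ((‖u x‖ ^ 2 : ℝ) : ℂ)) 2 (volume : Measure Plane) then h.toLp _ else 0

/-- The quantity `∫ 𝓛(|u|²) |u|² dx`. The symbol of `𝓛` is real and even, so that `𝓛(|u|²)` is
real-valued and taking the real part only changes the type. -/
def quartic (ν γ : ℝ) (u : H1) : ℝ :=
  (∫ x, opL ν γ (normSq (toL2 u)) x * normSq (toL2 u) x).re

/-- The constants `C` with `∫ 𝓛(|u|²) |u|² dx ≤ C ‖∇u‖₂² ‖u‖₂²` for all `u ∈ H¹(ℝ²)`. -/
def admissibleConstants (ν γ : ℝ) : Set ℝ :=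
  {C | ∀ u : H1, quartic ν γ u ≤ C * ‖grad u‖ ^ 2 * ‖toL2 u‖ ^ 2}

/-- The optimal constant in `∫ 𝓛(|u|²) |u|² dx ≤ C ‖∇u‖₂² ‖u‖₂²`. -/
def Copt (ν γ : ℝ) : ℝ := sInf (admissibleConstants ν γ)

/-- Weak convergence in the Hilbert space `H¹(ℝ²)`. -/
def WeaklyConverges (w : ℕ → H1) (V : H1) : Prop :=
  ∀ ℓ : H1 →L[ℂ] ℂ, Tendsto (fun k => ℓ (w k)) atTop (𝓝 (ℓ V))

end DaveyStewartson

end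

/-!
Call a weak limit of translates of a subsequence of `v` a translated limit, and pass to a
subsequence along which mass, Dirichlet energy and the quartic functional converge. As long as the
limit of the quartic functional is at least `ε > 0`, a frequency cutoff shows that some translates
do not converge weakly to zero. Subtracting a nonzero translated limit `V` splits all three
quantities asymptotically (for the quartic one this is a Brezis–Lieb argument, based on the local
compactness of `H¹ ⊂ L²`), and translated limits of the remainder are again zero or translated
limits of `v`. The mass removed is bounded below, so that after finitely many steps the quartic
functional of the remainder is at most `ε`. Each `V` contributes at most `C ‖∇V‖² ‖V‖²` to the
quartic functional and the energies `‖∇V‖²` add up to at most `M²`, so that the quartic functional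
has limit at most `C M² sup ‖V‖²`. Applying this bound to the remainder after one extraction makes
the inequality strict, which replaces the supremum by a translated limit attaining the bound.
-/

noncomputable section

namespace DaveyStewartson

section LpNorm

variable {α F G H : Type*} [MeasurableSpace α] {μ : Measure α} [NormedAddCommGroup F]
  [NormedAddCommGroup G] [NormedAddCommGroup H] {p : ℝ≥0∞}

theorem integrable_norm_sq (f : Lp F 2 μ) : Integrable (fun x => ‖f x‖ ^ 2) μ :=
  (Lp.memLp f).integrable_norm_pow (by norm_num)

theorem norm_sq_eq_integral (f : Lp F 2 μ) : ‖f‖ ^ 2 = ∫ x, ‖f x‖ ^ 2 ∂μ := by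
  have hnonneg : 0 ≤ ∫ x, ‖f x‖ ^ 2 ∂μ := integral_nonneg fun _ => by positivity
  rw [Lp.norm_def, (Lp.memLp f).eLpNorm_eq_integral_rpow_norm two_ne_zero ENNReal.ofNat_ne_top]
  simp only [ENNReal.toReal_ofNat, Real.rpow_ofNat]
  rw [ENNReal.toReal_ofReal (by positivity), ← Real.rpow_mul_natCast hnonneg]
  norm_num

theorem integrable_indicator_of_measure_ne_top (hp : 1 ≤ p) (f : Lp F p μ) {s : Set α}
    (hs : MeasurableSet s) (hμs : μ s ≠ ∞) : Integrable (s.indicator f) μ := by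
  have : IsFiniteMeasure (μ.restrict s) := isFiniteMeasure_restrict.2 hμs
  exact (integrable_indicator_iff hs).2 (((Lp.memLp f).restrict s).integrable hp)

theorem norm_le_add_of_ae_le [Fact (1 ≤ p)] {f : Lp F p μ} {g : Lp G p μ} {h : Lp H p μ} {a b : ℝ}
    (ha : 0 ≤ a) (hb : 0 ≤ b) (hfgh : ∀ᵐ x ∂μ, ‖f x‖ ≤ a * ‖g x‖ + b * ‖h x‖) :
    ‖f‖ ≤ a * ‖g‖ + b * ‖h‖ := by
  have hg := (Lp.memLp g).norm
  have hh := (Lp.memLp h).norm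
  calc ‖f‖ ≤ ‖a • hg.toLp + b • hh.toLp‖ := by
        apply Lp.norm_le_norm_of_ae_le
        filter_upwards [hfgh, Lp.coeFn_add (a • hg.toLp) (b • hh.toLp), Lp.coeFn_smul a hg.toLp,
          Lp.coeFn_smul b hh.toLp, hg.coeFn_toLp, hh.coeFn_toLp] with x hx hadd hag hbh hgx hhx
        rw [hadd, Pi.add_apply, hag, hbh, Pi.smul_apply, Pi.smul_apply, hgx, hhx]
        exact hx.trans (le_abs_self _)
    _ ≤ ‖a • hg.toLp‖ + ‖b • hh.toLp‖ := norm_add_le _ _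
    _ = a * ‖g‖ + b * ‖h‖ := by
        rw [norm_smul, norm_smul, Real.norm_of_nonneg ha, Real.norm_of_nonneg hb, Lp.norm_toLp,
          Lp.norm_toLp, eLpNorm_norm, eLpNorm_norm, ← Lp.norm_def, ← Lp.norm_def]

end LpNorm

section WeakConvergence

variable {ι 𝕜 E : Type*} [RCLike 𝕜] [NormedAddCommGroup E] [InnerProductSpace 𝕜 E] {l : Filter ι}
  {x y b : ι → E} {a : E} {K : ℝ}

theorem tendsto_inner_of_tendsto_left {c : 𝕜} (hx : Tendsto x l (𝓝 a)) (hy : ∀ k, ‖y k‖ ≤ K)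
    (h : Tendsto (fun k => inner 𝕜 a (y k)) l (𝓝 c)) :
    Tendsto (fun k => inner 𝕜 (x k) (y k)) l (𝓝 c) := by
  have hdiff : Tendsto (fun k => inner 𝕜 (x k - a) (y k)) l (𝓝 0) := by
    refine squeeze_zero_norm (a := fun k => ‖x k - a‖ * K) (fun k => ?_) ?_
    · exact (norm_inner_le_norm _ _).trans (mul_le_mul_of_nonneg_left (hy k) (norm_nonneg _))
    · simpa using (hx.sub_const a).norm.mul_const K
  simpa [inner_sub_left] using hdiff.add h

theorem tendsto_inner_comm {c : 𝕜} :
    Tendsto (fun k => inner 𝕜 (x k) (y k)) l (𝓝 c) ↔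
      Tendsto (fun k => inner 𝕜 (y k) (x k)) l (𝓝 (starRingEnd 𝕜 c)) := by
  have conj_tendsto {x y : ι → E} {c : 𝕜} (h : Tendsto (fun k => inner 𝕜 (x k) (y k)) l (𝓝 c)) :
      Tendsto (fun k => inner 𝕜 (y k) (x k)) l (𝓝 (starRingEnd 𝕜 c)) := by
    simpa only [Function.comp_def, inner_conj_symm] using
      (RCLike.continuous_conj.tendsto c).comp h
  exact ⟨conj_tendsto, fun h => by simpa using conj_tendsto h⟩

theorem tendsto_norm_sub_sq {s : ℝ} (h : Tendsto (fun k => inner 𝕜 a (x k)) l (𝓝 (inner 𝕜 a a)))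
    (hs : Tendsto (fun k => ‖x k‖ ^ 2) l (𝓝 s)) :
    Tendsto (fun k => ‖x k - a‖ ^ 2) l (𝓝 (s - ‖a‖ ^ 2)) := by
  have hre := (RCLike.continuous_re.tendsto _).comp h
  have hlim := (hs.sub (hre.const_mul 2)).add_const (‖a‖ ^ 2)
  rw [inner_self_eq_norm_sq] at hlim
  refine (hlim.congr fun k => ?_).trans (le_of_eq (by ring_nf))
  rw [@norm_sub_sq 𝕜, ← inner_re_symm]
  rfl

theorem isClosed_setOf_tendsto_inner_zero (hb : ∀ k, ‖b k‖ ≤ K) :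
    IsClosed {f : E | Tendsto (fun k => inner 𝕜 f (b k)) l (𝓝 0)} := by
  refine isClosed_of_closure_subset fun f hf => Metric.tendsto_nhds.2 fun ε hε => ?_
  obtain ⟨g, hg, hfg⟩ := Metric.mem_closure_iff.1 hf (ε / (2 * (|K| + 1))) (by positivity)
  filter_upwards [Metric.tendsto_nhds.1 hg (ε / 2) (by positivity)] with k hk
  rw [dist_zero_right] at hk ⊢
  have hsub : ‖inner 𝕜 (f - g) (b k)‖ ≤ ε / 2 :=
    calc ‖inner 𝕜 (f - g) (b k)‖ ≤ dist f g * ‖b k‖ := by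
          rw [dist_eq_norm]
          exact norm_inner_le_norm _ _
      _ ≤ ε / (2 * (|K| + 1)) * (|K| + 1) := by
          gcongr
          linarith [hb k, le_abs_self K]
      _ = ε / 2 := by field_simp
  calc ‖inner 𝕜 f (b k)‖ = ‖inner 𝕜 (f - g) (b k) + inner 𝕜 g (b k)‖ := by
        rw [← inner_add_left, sub_add_cancel]
    _ ≤ ‖inner 𝕜 (f - g) (b k)‖ + ‖inner 𝕜 g (b k)‖ := norm_add_le _ _
    _ < ε := by linarith

theorem tendsto_inner_clm_sub_inner_clm [CompleteSpace E] (L : E →L[𝕜] E) (hb : ∀ k, ‖b k‖ ≤ K)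
    (hb₀ : ∀ f, Tendsto (fun k => inner 𝕜 f (b k)) l (𝓝 0))
    (hxb : Tendsto (fun k => x k - b k) l (𝓝 a)) :
    Tendsto (fun k => inner 𝕜 (x k) (L (x k)) - inner 𝕜 (b k) (L (b k))) l
      (𝓝 (inner 𝕜 a (L a))) := by
  set d : ι → E := fun k => x k - b k
  have hL (M : E →L[𝕜] E) : Tendsto (fun k => M (d k)) l (𝓝 (M a)) :=
    (M.continuous.tendsto a).comp hxb
  have hdb : Tendsto (fun k => inner 𝕜 (d k) (L (b k))) l (𝓝 0) := by
    simpa only [ContinuousLinearMap.adjoint_inner_left] using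
      tendsto_inner_of_tendsto_left (hL (ContinuousLinearMap.adjoint L)) hb (hb₀ _)
  have hbd : Tendsto (fun k => inner 𝕜 (b k) (L (d k))) l (𝓝 0) :=
    tendsto_inner_comm.2 (by simpa using tendsto_inner_of_tendsto_left (hL L) hb (hb₀ _))
  have hsum := ((hxb.inner (𝕜 := 𝕜) (hL L)).add hdb).add hbd
  simp only [add_zero] at hsum
  refine hsum.congr fun k => ?_
  simp only [d, map_sub, inner_sub_left, inner_sub_right]
  ring

theorem exists_tendsto_inner_subseq [CompleteSpace E] [TopologicalSpace.SeparableSpace E]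
    {w : ℕ → E} (hw : ∀ n, ‖w n‖ ≤ K) : ∃ (V : E) (φ : ℕ → ℕ), StrictMono φ ∧
      ∀ ψ, Tendsto (fun k => inner 𝕜 ψ (w (φ k))) atTop (𝓝 (inner 𝕜 ψ V)) := by
  obtain ⟨T, -, φ, hφ, hT⟩ := WeakDual.isSeqCompact_closedBall (𝕜 := 𝕜) (E := E) 0 K
    (x := fun n => StrongDual.toWeakDual (InnerProductSpace.toDual 𝕜 E (w n))) (fun n => by
      rw [Set.mem_preimage, mem_closedBall_zero_iff]
      exact ((InnerProductSpace.toDual 𝕜 E).norm_map (w n)).trans_le (hw n))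
  refine ⟨(InnerProductSpace.toDual 𝕜 E).symm (WeakDual.toStrongDual T), φ, hφ, fun ψ => ?_⟩
  rw [← inner_conj_symm]
  refine tendsto_inner_comm.1 ?_
  rw [InnerProductSpace.toDual_symm_apply]
  exact ((WeakDual.eval_continuous ψ).tendsto T).comp hT

end WeakConvergence

section OptimalConstant

variable {X : Type*} {f g : X → ℝ} {c : ℝ} {x₀ : X}

theorem pos_of_forall_le_mul (hg : ∀ x, 0 ≤ g x) (hx₀ : 0 < f x₀) (hc : ∀ x, f x ≤ c * g x) :
    0 < c :=
  pos_of_mul_pos_left (hx₀.trans_le (hc x₀)) (hg x₀)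

theorem isLeast_sInf_setOf_forall_le_mul (hg : ∀ x, 0 ≤ g x) (hx₀ : 0 < f x₀)
    (hc : ∀ x, f x ≤ c * g x) :
    IsLeast {C : ℝ | ∀ x, f x ≤ C * g x} (sInf {C : ℝ | ∀ x, f x ≤ C * g x}) := by
  refine IsClosed.isLeast_csInf ?_ ⟨c, hc⟩ ⟨0, fun C hC => (pos_of_forall_le_mul hg hx₀ hC).le⟩
  rw [Set.ofPred_forall]
  exact isClosed_iInter fun x => isClosed_le continuous_const (continuous_mul_const (g x))

end OptimalConstant

theorem exists_subseq_tendsto_or_tendsto_cocompact {X : Type*} [TopologicalSpace X]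
    [FirstCountableTopology X] (z : ℕ → X) :
    (∃ (z₀ : X) (σ : ℕ → ℕ), StrictMono σ ∧ Tendsto (z ∘ σ) atTop (𝓝 z₀)) ∨
      Tendsto z atTop (cocompact X) := by
  refine or_iff_not_imp_right.2 fun h => ?_
  simp only [(hasBasis_cocompact (X := X)).tendsto_right_iff, not_forall] at h
  obtain ⟨K, hK, hfreq⟩ := h
  obtain ⟨z₀, -, σ, hσ, hlim⟩ := hK.tendsto_subseq' (by
    simpa only [Set.mem_compl_iff, not_eventually, not_not] using hfreq)
  exact ⟨z₀, σ, hσ, hlim⟩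

section Translation

variable {V F : Type*} [NormedAddCommGroup V] [InnerProductSpace ℝ V] [FiniteDimensional ℝ V]
  [MeasurableSpace V] [BorelSpace V] [NormedAddCommGroup F] [NormedSpace ℂ F]

/-- The translate `f(· + a)` of `f ∈ Lᵖ`, as an isometry. -/
def translationₗᵢ {p : ℝ≥0∞} [Fact (1 ≤ p)] (a : V) :
    Lp F p (volume : Measure V) →ₗᵢ[ℂ] Lp F p (volume : Measure V) :=
  Lp.compMeasurePreservingₗᵢ ℂ (fun x => x + a) (measurePreserving_add_right volume a)

theorem translationₗᵢ_toLp (a : V) (φ : 𝓢(V, F)) :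
    translationₗᵢ a (φ.toLp 2) = (φ.compSubConstCLM ℂ (-a)).toLp 2 := by
  apply Lp.ext
  have hmp := measurePreserving_add_right (volume : Measure V) a
  filter_upwards [Lp.coeFn_compMeasurePreserving (φ.toLp 2) hmp,
    hmp.quasiMeasurePreserving.ae_eq (φ.coeFn_toLp 2), (φ.compSubConstCLM ℂ (-a)).coeFn_toLp 2]
    with x htrans hφ hcomp
  rw [hcomp, SchwartzMap.compSubConstCLM_apply, sub_neg_eq_add]
  exact htrans.trans hφ

/-- The symbol `ξ ↦ exp (2πi ⟨a, ξ⟩)` of the translation `f ↦ f(· + a)`. -/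
def character (a ξ : V) : ℂ := Real.fourierChar (inner ℝ a ξ)

theorem memLp_character (a : V) : MemLp (character a) ∞ (volume : Measure V) := by
  have hcont : Continuous (character a) := by
    unfold character
    fun_prop
  exact memLp_top_of_bound hcont.aestronglyMeasurable 1
    (Eventually.of_forall fun ξ => (Circle.norm_coe _).le)

theorem fourier_compSubConst_neg (a : V) (φ : 𝓢(V, F)) (ξ : V) :
    𝓕 (φ.compSubConstCLM ℂ (-a)) ξ = character a ξ • 𝓕 φ ξ := by
  rw [SchwartzMap.fourier_coe, SchwartzMap.fourier_coe]
  have hcomp : ⇑(φ.compSubConstCLM ℂ (-a)) = φ ∘ fun x => x + a := by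
    ext x
    simp
  rw [hcomp]
  exact congrFun (VectorFourier.fourierIntegral_comp_add_right Real.fourierChar
    (volume : Measure V) (innerₗ V) φ a) ξ

end Translation

section FourierMultiplier

variable {V F : Type*} [NormedAddCommGroup V] [InnerProductSpace ℝ V] [FiniteDimensional ℝ V]
  [MeasurableSpace V] [BorelSpace V] [NormedAddCommGroup F] [InnerProductSpace ℂ F]
  [CompleteSpace F]

local notation "L²" => Lp F 2 (volume : Measure V)

/-- The operator `f ↦ 𝓕⁻¹ (m 𝓕 f)` on `L²` with a bounded symbol `m`. -/
def fourierMul (m : Lp ℂ ∞ (volume : Measure V)) : L² →L[ℂ] L² :=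
  (Lp.fourierTransformₗᵢ V F).symm.toContinuousLinearEquiv.toContinuousLinearMap ∘L
    (ContinuousLinearMap.lsmul ℂ ℂ).holderL volume ∞ 2 2 m ∘L
      (Lp.fourierTransformₗᵢ V F).toContinuousLinearEquiv.toContinuousLinearMap

theorem fourierMul_eq_fourierInv_smul (m : Lp ℂ ∞ (volume : Measure V)) (f : L²) :
    fourierMul m f = 𝓕⁻ (m • (𝓕 f : L²) : L²) := rfl

theorem coeFn_fourier_fourierMul (m : Lp ℂ ∞ (volume : Measure V)) (f : L²) :
    (𝓕 (fourierMul m f) : L²) =ᵐ[volume] fun ξ => m ξ • (𝓕 f : L²) ξ := by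
  rw [fourierMul_eq_fourierInv_smul, FourierTransform.fourier_fourierInv_eq]
  exact Lp.coeFn_lpSMul _ _

theorem fourierMul_character (a : V) :
    fourierMul ((memLp_character a).toLp (character a)) =
      (translationₗᵢ a : L² →ₗᵢ[ℂ] _).toContinuousLinearMap := by
  refine ContinuousLinearMap.coeFn_injective (DenseRange.equalizer
    (SchwartzMap.denseRange_toLpCLM (p := 2) ENNReal.ofNat_ne_top)
    (ContinuousLinearMap.continuous _) (ContinuousLinearMap.continuous _) (funext fun φ => ?_))
  refine (Lp.fourierTransformₗᵢ V F).injective (Lp.ext ?_)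
  change (𝓕 (fourierMul ((memLp_character a).toLp (character a)) (φ.toLp 2)) : L²)
    =ᵐ[volume] (𝓕 (translationₗᵢ a (φ.toLp 2)) : L²)
  rw [translationₗᵢ_toLp, SchwartzMap.toLp_fourier_eq]
  refine (coeFn_fourier_fourierMul _ _).trans ?_
  rw [SchwartzMap.toLp_fourier_eq]
  filter_upwards [(𝓕 (φ.compSubConstCLM ℂ (-a))).coeFn_toLp 2, (𝓕 φ).coeFn_toLp 2,
    (memLp_character a).coeFn_toLp] with ξ hcomp hφ hchar
  rw [hcomp, hφ, hchar, fourier_compSubConst_neg]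

theorem coeFn_fourier_translationₗᵢ (a : V) (f : L²) :
    (𝓕 (translationₗᵢ a f) : L²) =ᵐ[volume] fun ξ => character a ξ • (𝓕 f : L²) ξ := by
  have h := coeFn_fourier_fourierMul ((memLp_character a).toLp (character a)) f
  rw [fourierMul_character] at h
  filter_upwards [h, (memLp_character a).coeFn_toLp] with ξ hξ hchar
  rw [← hchar]
  exact hξ

theorem fourierMul_translationₗᵢ (m : Lp ℂ ∞ (volume : Measure V)) (a : V) (f : L²) :
    fourierMul m (translationₗᵢ a f) = translationₗᵢ a (fourierMul m f) := by
  refine (Lp.fourierTransformₗᵢ V F).injective (Lp.ext ?_)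
  filter_upwards [coeFn_fourier_fourierMul m (translationₗᵢ a f), coeFn_fourier_translationₗᵢ a f,
    coeFn_fourier_translationₗᵢ a (fourierMul m f), coeFn_fourier_fourierMul m f]
    with ξ hmt ht htm hm
  refine hmt.trans (Eq.trans ?_ htm.symm)
  rw [ht, hm, smul_comm]

theorem tendsto_inner_translationₗᵢ_cocompact (f g : L²) :
    Tendsto (fun a => inner ℂ f (translationₗᵢ a g)) (cocompact V) (𝓝 0) := by
  have hRL := (tendsto_integral_exp_inner_smul_cocompact fun ξ : V =>
    inner ℂ ((𝓕 f : L²) ξ) ((𝓕 g : L²) ξ)).comp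
      (Homeomorph.neg V).isClosedEmbedding.tendsto_cocompact
  refine hRL.congr fun a => ?_
  rw [← Lp.inner_fourier_eq, L2.inner_def]
  apply integral_congr_ae
  filter_upwards [coeFn_fourier_translationₗᵢ a g] with ξ hξ
  rw [hξ, inner_smul_right, character]
  simp only [Homeomorph.coe_neg, inner_neg_right, neg_neg, Circle.smul_def, smul_eq_mul,
    real_inner_comm]

end FourierMultiplier

section WeakDerivative

variable {V F : Type*} [NormedAddCommGroup V] [MeasurableSpace V] [BorelSpace V]

theorem ae_eq_of_integral_schwartz_smul_eq [NormedSpace ℝ V] [FiniteDimensional ℝ V]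
    [NormedAddCommGroup F] [NormedSpace ℂ F] [CompleteSpace F] {μ : Measure V} {f g : V → F}
    (hf : LocallyIntegrable f μ) (hg : LocallyIntegrable g μ)
    (h : ∀ φ : 𝓢(V, ℂ), ∫ x, φ x • f x ∂μ = ∫ x, φ x • g x ∂μ) : f =ᵐ[μ] g := by
  refine ae_eq_of_integral_contDiff_smul_eq hf hg fun k hk hk' => ?_
  have hsmooth : ContDiff ℝ (⊤ : ℕ∞) fun x => (k x : ℂ) := Complex.ofRealCLM.contDiff.comp hk
  have hsupp : HasCompactSupport fun x => (k x : ℂ) := hk'.comp_left Complex.ofReal_zero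
  simpa using h (hsupp.toSchwartzMap hsmooth)

variable [InnerProductSpace ℝ V] [FiniteDimensional ℝ V] [NormedAddCommGroup F]
  [InnerProductSpace ℂ F] [CompleteSpace F]

local notation "L²" => Lp F 2 (volume : Measure V)

theorem fourier_lineDeriv_apply (u : L²) (v : V) (φ : 𝓢(V, ℂ)) :
    𝓕 (∂_{v} (u : 𝓢'(V, F))) φ = ∫ ξ, φ ξ •
      ((2 * Real.pi * Complex.I * (inner ℝ ξ v : ℝ)) • (𝓕 u : L²) ξ) := by
  have hgrowth : (fun ξ : V => ((inner ℝ ξ v : ℝ) : ℂ)).HasTemperateGrowth := by fun_prop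
  rw [TemperedDistribution.fourier_lineDerivOp_eq, Lp.fourier_toTemperedDistribution_eq]
  simp only [smul_apply, TemperedDistribution.smulLeftCLM_apply_apply,
    Lp.toTemperedDistribution_apply]
  rw [← integral_smul]
  congr 1
  ext ξ
  rw [SchwartzMap.smulLeftCLM_apply_apply hgrowth, smul_eq_mul, smul_smul, smul_smul]
  congr 1
  ring

theorem lineDeriv_eq_iff_fourier (u g : L²) (v : V) :
    ∂_{v} (u : 𝓢'(V, F)) = (g : 𝓢'(V, F)) ↔
      (𝓕 g : L²) =ᵐ[volume]
        fun ξ => (2 * Real.pi * Complex.I * (inner ℝ ξ v : ℝ)) • (𝓕 u : L²) ξ := by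
  have hloc (f : L²) : LocallyIntegrable f (volume : Measure V) :=
    (Lp.memLp f).locallyIntegrable one_le_two
  have hsymbol : Continuous fun ξ : V => 2 * Real.pi * Complex.I * (inner ℝ ξ v : ℝ) := by fun_prop
  have hfourier : ∂_{v} (u : 𝓢'(V, F)) = (g : 𝓢'(V, F)) ↔
      𝓕 (∂_{v} (u : 𝓢'(V, F))) = ((𝓕 g : L²) : 𝓢'(V, F)) := by
    rw [← Lp.fourier_toTemperedDistribution_eq]
    exact ⟨congrArg _, fun h => by
      simpa only [FourierTransform.fourierInv_fourier_eq] using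
        congrArg (fun T : 𝓢'(V, F) => 𝓕⁻ T) h⟩
  rw [hfourier]
  refine ⟨fun h => ?_, fun h => ?_⟩
  · refine ae_eq_of_integral_schwartz_smul_eq (hloc _)
      ((hloc (𝓕 u)).continuous_smul hsymbol) fun φ => ?_
    rw [← fourier_lineDeriv_apply, h, Lp.toTemperedDistribution_apply]
  · ext φ
    rw [fourier_lineDeriv_apply, Lp.toTemperedDistribution_apply]
    refine integral_congr_ae ?_
    filter_upwards [h] with ξ hξ
    rw [hξ]

theorem lineDeriv_fourierMul {u g : L²} {v : V} (h : ∂_{v} (u : 𝓢'(V, F)) = (g : 𝓢'(V, F)))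
    (m : Lp ℂ ∞ (volume : Measure V)) :
    ∂_{v} (fourierMul m u : 𝓢'(V, F)) = (fourierMul m g : 𝓢'(V, F)) := by
  rw [lineDeriv_eq_iff_fourier] at h ⊢
  filter_upwards [coeFn_fourier_fourierMul m g, coeFn_fourier_fourierMul m u, h] with ξ hg hu hξ
  rw [hg, hu, hξ, smul_comm]

end WeakDerivative

section LowFrequencies

variable {V F : Type*} [NormedAddCommGroup V] [InnerProductSpace ℝ V] [FiniteDimensional ℝ V]
  [MeasurableSpace V] [BorelSpace V] [NormedAddCommGroup F] [InnerProductSpace ℂ F]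
  [CompleteSpace F]

local notation "L²" => Lp F 2 (volume : Measure V)

theorem coeFn_fourierInv_of_integrable {f : L²} (hf : Integrable f) :
    (𝓕⁻ f : L²) =ᵐ[volume] 𝓕⁻ (f : V → F) := by
  have hL : Continuous fun p : V × V => (-innerₗ V) p.1 p.2 := by
    simp only [LinearMap.neg_apply, innerₗ_apply_apply]
    fun_prop
  have hflip : (-innerₗ V).flip = -innerₗ V := by
    ext x y
    simp [real_inner_comm]
  have hcont : Continuous (𝓕⁻ (f : V → F)) :=
    VectorFourier.fourierIntegral_continuous Real.continuous_fourierChar hL hf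
  refine ae_eq_of_integral_schwartz_smul_eq ((Lp.memLp (𝓕⁻ f : L²)).locallyIntegrable one_le_two)
    hcont.locallyIntegrable fun φ => ?_
  rw [← Lp.toTemperedDistribution_apply, ← Lp.fourierInv_toTemperedDistribution_eq,
    TemperedDistribution.fourierInv_apply, Lp.toTemperedDistribution_apply]
  have hparseval := VectorFourier.integral_fourierIntegral_smul_eq_flip (L := -innerₗ V)
    (μ := (volume : Measure V)) (ν := (volume : Measure V)) Real.continuous_fourierChar hL
    φ.integrable hf
  rw [hflip] at hparseval
  rw [SchwartzMap.fourierInv_coe]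
  exact hparseval

theorem memLp_lowPassSymbol (N : ℝ) :
    MemLp ((Metric.ball (0 : V) N).indicator fun _ => (1 : ℂ)) ∞ volume :=
  (memLp_top_const 1).indicator measurableSet_ball

/-- The projection of `L²` onto the frequencies `|ξ| < N`. -/
def lowPass (N : ℝ) : L² →L[ℂ] L² :=
  fourierMul (memLp_lowPassSymbol N).toLp

theorem coeFn_fourier_lowPass (N : ℝ) (f : L²) :
    (𝓕 (lowPass N f) : L²) =ᵐ[volume] (Metric.ball 0 N).indicator (𝓕 f : L²) := by
  refine (coeFn_fourier_fourierMul _ f).trans ?_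
  filter_upwards [(memLp_lowPassSymbol (V := V) N).coeFn_toLp] with ξ hξ
  rw [hξ]
  by_cases h : ξ ∈ Metric.ball 0 N
  · rw [Set.indicator_of_mem h, Set.indicator_of_mem h, one_smul]
  · rw [Set.indicator_of_notMem h, Set.indicator_of_notMem h, zero_smul]

theorem coeFn_fourier_sub_lowPass (N : ℝ) (f : L²) :
    (𝓕 (f - lowPass N f) : L²) =ᵐ[volume] (Metric.ball 0 N)ᶜ.indicator (𝓕 f : L²) := by
  have hsub : (𝓕 (f - lowPass N f) : L²) = 𝓕 f - 𝓕 (lowPass N f) :=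
    (Lp.fourierTransformₗᵢ V F).map_sub f (lowPass N f)
  rw [hsub]
  filter_upwards [Lp.coeFn_sub (𝓕 f : L²) (𝓕 (lowPass N f) : L²), coeFn_fourier_lowPass N f]
    with ξ hsub hlow
  rw [hsub, Pi.sub_apply, hlow, Set.indicator_compl, Pi.sub_apply]

theorem norm_le_of_fourier_ae_eq_indicator {f g : L²} {S : Set V}
    (h : (𝓕 g : L²) =ᵐ[volume] S.indicator (𝓕 f : L²)) : ‖g‖ ≤ ‖f‖ := by
  rw [← Lp.norm_fourier_eq, ← Lp.norm_fourier_eq f]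
  apply Lp.norm_le_norm_of_ae_le
  filter_upwards [h] with ξ hξ
  rw [hξ]
  exact norm_indicator_le_norm_self _ _

theorem norm_lowPass_le (N : ℝ) (f : L²) : ‖lowPass N f‖ ≤ ‖f‖ :=
  norm_le_of_fourier_ae_eq_indicator (coeFn_fourier_lowPass N f)

theorem norm_sub_lowPass_le (N : ℝ) (f : L²) : ‖f - lowPass N f‖ ≤ ‖f‖ :=
  norm_le_of_fourier_ae_eq_indicator (coeFn_fourier_sub_lowPass N f)

theorem coeFn_lowPass (N : ℝ) (f : L²) :
    lowPass N f =ᵐ[volume] 𝓕⁻ ((Metric.ball 0 N).indicator (𝓕 f : L²)) := by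
  have hlow := coeFn_fourier_lowPass N f
  have h := coeFn_fourierInv_of_integrable
    ((integrable_indicator_of_measure_ne_top one_le_two (𝓕 f : L²) measurableSet_ball
      measure_ball_lt_top.ne).congr hlow.symm)
  rw [FourierTransform.fourierInv_fourier_eq] at h
  refine h.trans (Eventually.of_forall fun x => ?_)
  simp only [Real.fourierInv_eq]
  apply integral_congr_ae
  filter_upwards [hlow] with ξ hξ
  rw [hξ]

/-- The convolution kernel of `lowPass N`, up to a reflection. -/
def lowKernel (N : ℝ) : Lp ℂ 2 (volume : Measure V) :=
  𝓕⁻ (indicatorConstLp 2 (measurableSet_ball (x := (0 : V)) (ε := N)) measure_ball_lt_top.ne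
    (1 : ℂ) : Lp ℂ 2 (volume : Measure V))

theorem inner_lowKernel_translationₗᵢ (N : ℝ) (f : Lp ℂ 2 (volume : Measure V)) (y : V) :
    inner ℂ (lowKernel N) (translationₗᵢ y f)
      = 𝓕⁻ ((Metric.ball 0 N).indicator (𝓕 f : Lp ℂ 2 (volume : Measure V))) y := by
  rw [← Lp.inner_fourier_eq, lowKernel, FourierTransform.fourier_fourierInv_eq,
    L2.inner_indicatorConstLp_one, Real.fourierInv_eq, ← integral_indicator measurableSet_ball]
  apply integral_congr_ae
  filter_upwards [coeFn_fourier_translationₗᵢ y f] with ξ hξ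
  by_cases h : ξ ∈ Metric.ball 0 N
  · rw [Set.indicator_of_mem h, Set.indicator_of_mem h, hξ, character, real_inner_comm,
      Circle.smul_def]
  · rw [Set.indicator_of_notMem h, Set.indicator_of_notMem h, smul_zero]

theorem coeFn_lowPass_eq_inner (N : ℝ) (f : Lp ℂ 2 (volume : Measure V)) :
    lowPass N f =ᵐ[volume] fun y => inner ℂ (lowKernel N) (translationₗᵢ y f) := by
  simpa only [inner_lowKernel_translationₗᵢ] using coeFn_lowPass N f

end LowFrequencies

theorem shift_eq_translationₗᵢ (a : Plane) (f : L2) : shift a f = translationₗᵢ a f := rfl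

theorem shift_shift (a b : Plane) (f : L2) : shift a (shift b f) = shift (a + b) f := by
  apply Lp.ext
  filter_upwards [coeFn_shift a (shift b f), coeFn_shift (a + b) f,
    (measurePreserving_add_right volume a).quasiMeasurePreserving.ae_eq (coeFn_shift b f)]
    with x houter hsum hinner
  rw [houter, hsum, ← add_assoc]
  exact hinner

theorem shift_zero (f : L2) : shift 0 f = f := by
  apply Lp.ext
  filter_upwards [coeFn_shift 0 f] with x hx
  rw [hx, add_zero]

theorem continuous_shift_left (f : L2) : Continuous fun a => shift a f :=
  let G : C(Plane × Plane, Plane) := ⟨fun p => p.2 + p.1, by fun_prop⟩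
  (continuous_const (y := f)).compMeasurePreservingLp G.curry.continuous
    (fun a => measurePreserving_add_right volume a) ENNReal.ofNat_ne_top

section SobolevSpace

/-- `toL2` as a bounded operator. -/
def toL2CLM : H1 →L[ℂ] L2 :=
  WithLp.fstL 2 ℂ L2 (PiLp 2 fun _ : Fin 2 => L2) ∘L sobolevSubmodule.subtypeL

theorem toL2_zero : toL2 0 = 0 := map_zero toL2CLM

theorem toL2_sub (u w : H1) : toL2 (u - w) = toL2 u - toL2 w := map_sub toL2CLM u w

/-- The weak gradient as a bounded operator. -/
def gradCLM : H1 →L[ℂ] PiLp 2 fun _ : Fin 2 => L2 :=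
  WithLp.sndL 2 ℂ L2 (PiLp 2 fun _ : Fin 2 => L2) ∘L sobolevSubmodule.subtypeL

theorem grad_sub (u w : H1) : grad (u - w) = grad u - grad w := map_sub gradCLM u w

theorem H1_ext {u w : H1} (hL2 : toL2 u = toL2 w) (hgrad : ∀ i, grad u i = grad w i) : u = w :=
  Subtype.ext (WithLp.ofLp_injective _ (Prod.ext hL2 (PiLp.ext hgrad)))

theorem inner_eq_add (u w : H1) :
    inner ℂ u w = inner ℂ (toL2 u) (toL2 w) + inner ℂ (grad u) (grad w) := by
  rw [Submodule.coe_inner, WithLp.prod_inner_apply]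
  rfl

theorem norm_sq_eq_add (u : H1) : ‖u‖ ^ 2 = ‖toL2 u‖ ^ 2 + ‖grad u‖ ^ 2 :=
  WithLp.prod_norm_sq_eq_of_L2 (u : Pairs)

theorem norm_toL2_le (u : H1) : ‖toL2 u‖ ≤ ‖u‖ :=
  le_of_sq_le_sq (by linarith [norm_sq_eq_add u, sq_nonneg ‖grad u‖]) (norm_nonneg _)

theorem norm_grad_le (u : H1) : ‖grad u‖ ≤ ‖u‖ :=
  le_of_sq_le_sq (by linarith [norm_sq_eq_add u, sq_nonneg ‖toL2 u‖]) (norm_nonneg _)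

theorem isClosed_sobolevSubmodule : IsClosed (sobolevSubmodule : Set Pairs) := by
  have hinter : (sobolevSubmodule : Set Pairs) = ⋂ i, {p | IsWeakPartial i p.fst (p.snd i)} := by
    ext p
    simp [sobolevSubmodule]
  rw [hinter]
  refine isClosed_iInter fun i => ?_
  unfold IsWeakPartial
  simp only [← Lp.toTemperedDistributionCLM_apply]
  exact isClosed_eq
    (lineDerivOpCLM ℂ 𝓢'(Plane, ℂ) (EuclideanSpace.single i (1 : ℝ) : Plane) ∘L
      Lp.toTemperedDistributionCLM ℂ volume 2 ∘L
        WithLp.fstL 2 ℂ L2 (PiLp 2 fun _ : Fin 2 => L2)).continuous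
    (Lp.toTemperedDistributionCLM ℂ volume 2 ∘L PiLp.proj 2 (fun _ : Fin 2 => L2) i ∘L
      WithLp.sndL 2 ℂ L2 (PiLp 2 fun _ : Fin 2 => L2)).continuous

instance completeSpace_H1 : CompleteSpace H1 := isClosed_sobolevSubmodule.completeSpace_coe

instance secondCountableTopology_H1 : SecondCountableTopology H1 := by
  have : Fact ((2 : ℝ≥0∞) ≠ ∞) := ⟨ENNReal.ofNat_ne_top⟩
  have : SecondCountableTopology L2 := inferInstance
  have : SecondCountableTopology Pairs := inferInstance
  infer_instance

theorem toL2_translate (a : Plane) (u : H1) : toL2 (translate a u) = shift a (toL2 u) := rfl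

theorem grad_translate (a : Plane) (u : H1) (i : Fin 2) :
    grad (translate a u) i = shift a (grad u i) := rfl

theorem translate_translate (a b : Plane) (u : H1) :
    translate a (translate b u) = translate (a + b) u :=
  H1_ext (shift_shift _ _ _) fun _ => shift_shift _ _ _

theorem translate_zero (u : H1) : translate 0 u = u :=
  H1_ext (shift_zero _) fun _ => shift_zero _

theorem norm_toL2_translate (a : Plane) (u : H1) : ‖toL2 (translate a u)‖ = ‖toL2 u‖ :=
  (translationₗᵢ a).norm_map _

theorem norm_grad_translate (a : Plane) (u : H1) : ‖grad (translate a u)‖ = ‖grad u‖ := by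
  rw [← sq_eq_sq₀ (norm_nonneg _) (norm_nonneg _), PiLp.norm_sq_eq_of_L2, PiLp.norm_sq_eq_of_L2]
  simp only [grad_translate, shift_eq_translationₗᵢ, LinearIsometry.norm_map]

/-- Translation as a linear isometry of `H¹`. -/
def translateₗᵢ (a : Plane) : H1 →ₗᵢ[ℂ] H1 where
  toFun := translate a
  map_add' _ _ := H1_ext (map_add (translationₗᵢ a) _ _) fun _ => map_add (translationₗᵢ a) _ _
  map_smul' c _ := H1_ext (map_smul (translationₗᵢ a) c _) fun _ => map_smul (translationₗᵢ a) c _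
  norm_map' u := by
    rw [← sq_eq_sq₀ (norm_nonneg _) (norm_nonneg _), norm_sq_eq_add, norm_sq_eq_add]
    exact congrArg₂ (· ^ 2 + · ^ 2) (norm_toL2_translate a u) (norm_grad_translate a u)

theorem norm_translate (a : Plane) (u : H1) : ‖translate a u‖ = ‖u‖ := (translateₗᵢ a).norm_map u

theorem translate_sub (a : Plane) (u w : H1) :
    translate a (u - w) = translate a u - translate a w := (translateₗᵢ a).map_sub u w

theorem inner_translate_right (a : Plane) (u w : H1) :
    inner ℂ u (translate a w) = inner ℂ (translate (-a) u) w := by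
  have hu : translateₗᵢ a (translate (-a) u) = u := by
    change translate a (translate (-a) u) = u
    rw [translate_translate, add_neg_cancel, translate_zero]
  have hmap := LinearIsometry.inner_map_map (𝕜 := ℂ) (E := H1) (E' := H1) (translateₗᵢ a)
    (translate (-a) u) w
  rwa [hu] at hmap

theorem continuous_translate_left (u : H1) : Continuous fun a => translate a u :=
  ((WithLp.prod_continuous_toLp 2 _ _).comp ((continuous_shift_left _).prodMk
    ((PiLp.continuous_toLp 2 _).comp
      (continuous_pi fun _ => continuous_shift_left _)))).subtype_mk _

theorem isWeakPartial_toLp (φ : 𝓢(Plane, ℂ)) (i : Fin 2) : IsWeakPartial i (φ.toLp 2)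
    ((∂_{(EuclideanSpace.single i (1 : ℝ) : Plane)} φ : 𝓢(Plane, ℂ)).toLp 2) := by
  unfold IsWeakPartial
  rw [Lp.toTemperedDistribution_toLp_eq, Lp.toTemperedDistribution_toLp_eq]
  exact TemperedDistribution.lineDerivOp_toTemperedDistributionCLM_eq φ _

/-- Schwartz functions as elements of `H¹`. -/
def ofSchwartz : 𝓢(Plane, ℂ) →ₗ[ℂ] H1 :=
  let toLp := (SchwartzMap.toLpCLM ℂ (E := Plane) ℂ 2 volume).toLinearMap
  let pderiv (i : Fin 2) :=
    (lineDerivOpCLM ℂ 𝓢(Plane, ℂ) (EuclideanSpace.single i (1 : ℝ) : Plane)).toLinearMap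
  ((WithLp.linearEquiv 2 ℂ _).symm.toLinearMap ∘ₗ toLp.prod
    ((WithLp.linearEquiv 2 ℂ _).symm.toLinearMap ∘ₗ
      LinearMap.pi fun i => toLp ∘ₗ pderiv i)).codRestrict sobolevSubmodule isWeakPartial_toLp

theorem toL2_ofSchwartz (φ : 𝓢(Plane, ℂ)) : toL2 (ofSchwartz φ) = φ.toLp 2 := rfl

theorem grad_ofSchwartz (φ : 𝓢(Plane, ℂ)) (i : Fin 2) : grad (ofSchwartz φ) i
    = (∂_{(EuclideanSpace.single i (1 : ℝ) : Plane)} φ : 𝓢(Plane, ℂ)).toLp 2 := rfl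

theorem coeFn_fourier_grad (u : H1) (i : Fin 2) : (𝓕 (grad u i) : L2) =ᵐ[volume]
    fun ξ => (2 * Real.pi * Complex.I * ξ i) • (𝓕 (toL2 u) : L2) ξ := by
  simpa only [EuclideanSpace.inner_single_right, conj_trivial, one_mul] using
    (lineDeriv_eq_iff_fourier (toL2 u) (grad u i) _).1 (u.2 i)

theorem sum_inner_fourier_grad_ae_eq (u w : H1) :
    (fun ξ => ∑ i, inner ℂ ((𝓕 (grad u i) : L2) ξ) ((𝓕 (grad w i) : L2) ξ)) =ᵐ[volume]
      fun ξ => (2 * Real.pi * ‖ξ‖) ^ 2 •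
        inner ℂ ((𝓕 (toL2 u) : L2) ξ) ((𝓕 (toL2 w) : L2) ξ) := by
  filter_upwards [ae_all_iff.2 (coeFn_fourier_grad u), ae_all_iff.2 (coeFn_fourier_grad w)]
    with ξ hu hw
  simp only [hu, hw, mul_pow, EuclideanSpace.real_norm_sq_eq, inner_smul_left, inner_smul_right,
    Fin.sum_univ_two, Complex.real_smul, map_mul, Complex.conj_ofReal, Complex.conj_I,
    Complex.conj_ofNat]
  push_cast
  linear_combination (-4 * (Real.pi : ℂ) ^ 2 * ((ξ 0 : ℂ) ^ 2 + (ξ 1 : ℂ) ^ 2) *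
    inner ℂ ((𝓕 (toL2 u) : L2) ξ) ((𝓕 (toL2 w) : L2) ξ)) * Complex.I_sq

theorem integrable_sq_norm_smul_inner_fourier (u w : H1) :
    Integrable fun ξ => (2 * Real.pi * ‖ξ‖) ^ 2 •
      inner ℂ ((𝓕 (toL2 u) : L2) ξ) ((𝓕 (toL2 w) : L2) ξ) :=
  (integrable_finsetSum _ fun _ _ => L2.integrable_inner _ _).congr
    (sum_inner_fourier_grad_ae_eq u w)

theorem inner_grad_eq_integral_fourier (u w : H1) :
    inner ℂ (grad u) (grad w) = ∫ ξ, (2 * Real.pi * ‖ξ‖) ^ 2 •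
      inner ℂ ((𝓕 (toL2 u) : L2) ξ) ((𝓕 (toL2 w) : L2) ξ) := by
  simp only [PiLp.inner_apply, ← Lp.inner_fourier_eq (grad u _), L2.inner_def]
  rw [← integral_finsetSum _ fun _ _ => L2.integrable_inner _ _]
  exact integral_congr_ae (sum_inner_fourier_grad_ae_eq u w)

theorem inner_eq_integral_fourier (u w : H1) :
    inner ℂ u w = ∫ ξ, (1 + (2 * Real.pi * ‖ξ‖) ^ 2) •
      inner ℂ ((𝓕 (toL2 u) : L2) ξ) ((𝓕 (toL2 w) : L2) ξ) := by
  simp only [add_smul, one_smul]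
  rw [inner_eq_add, inner_grad_eq_integral_fourier, ← Lp.inner_fourier_eq (toL2 u), L2.inner_def,
    integral_add (L2.integrable_inner _ _) (integrable_sq_norm_smul_inner_fourier u w)]

theorem toL2_injective : Function.Injective toL2 := by
  intro u w h
  refine H1_ext h fun i => (Lp.fourierTransformₗᵢ Plane ℂ).injective (Lp.ext ?_)
  have hu := coeFn_fourier_grad u i
  rw [h] at hu
  exact hu.trans (coeFn_fourier_grad w i).symm

theorem toL2_eq_zero_of_orthogonal {u : H1} (h : ∀ φ, inner ℂ u (ofSchwartz φ) = 0) :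
    toL2 u = 0 := by
  have hloc : LocallyIntegrable fun ξ : Plane => (1 + (2 * Real.pi * ‖ξ‖) ^ 2) •
      (starRingEnd ℂ) ((𝓕 (toL2 u) : L2) ξ) :=
    ((Lp.memLp (𝓕 (toL2 u) : L2)).star.locallyIntegrable one_le_two).continuous_smul
      (by fun_prop)
  have hzero : (fun ξ : Plane => (1 + (2 * Real.pi * ‖ξ‖) ^ 2) •
      (starRingEnd ℂ) ((𝓕 (toL2 u) : L2) ξ)) =ᵐ[volume] 0 := by
    refine ae_eq_of_integral_schwartz_smul_eq hloc (locallyIntegrable_const 0) fun φ => ?_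
    have hφ : (𝓕 (toL2 (ofSchwartz (𝓕⁻ φ))) : L2) = φ.toLp 2 := by
      rw [toL2_ofSchwartz, SchwartzMap.toLp_fourier_eq, fourier_fourierInv_eq]
    have hinner := h (𝓕⁻ φ)
    rw [inner_eq_integral_fourier, hφ] at hinner
    simp only [Pi.zero_apply, smul_zero, integral_zero]
    rw [← hinner]
    apply integral_congr_ae
    filter_upwards [φ.coeFn_toLp 2 volume] with ξ hξ
    rw [hξ, smul_comm, RCLike.inner_apply, smul_eq_mul]
  refine (Lp.fourierTransformₗᵢ Plane ℂ).injective
    (((Lp.eq_zero_iff_ae_eq_zero).2 ?_).trans (map_zero _).symm)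
  filter_upwards [hzero] with ξ hξ
  have hweight : (1 + (2 * Real.pi * ‖ξ‖) ^ 2) ≠ 0 := by positivity
  exact (map_eq_zero (starRingEnd ℂ)).1 ((smul_eq_zero.1 hξ).resolve_left hweight)

theorem denseRange_ofSchwartz : DenseRange ofSchwartz := by
  have htop : ofSchwartz.range.topologicalClosure = ⊤ := by
    refine (Submodule.topologicalClosure_eq_top_iff (𝕜 := ℂ) (E := H1)).2 (eq_bot_iff.2 ?_)
    intro u hu
    rw [Submodule.mem_orthogonal'] at hu
    exact (Submodule.mem_bot ℂ).2 (toL2_injective ((toL2_eq_zero_of_orthogonal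
      fun φ => hu _ ⟨φ, rfl⟩).trans toL2_zero.symm))
  exact Submodule.dense_iff_topologicalClosure_eq_top.2 htop

end SobolevSpace

section Cutoff

variable {E : Type*} [NormedAddCommGroup E] [NormedSpace ℝ E] [HasContDiffBump E]

theorem exists_norm_fderiv_bump_le [FiniteDimensional ℝ E] (χ : ContDiffBump (0 : E)) :
    ∃ c, ∀ x, ‖fderiv ℝ χ x‖ ≤ c :=
  (χ.hasCompactSupport.fderiv ℝ).exists_bound_of_continuous
    ((χ.contDiff (n := 1)).continuous_fderiv one_ne_zero)

theorem hasFDerivAt_bump_smul (χ : ContDiffBump (0 : E)) (r : ℝ) (x : E) :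
    HasFDerivAt (fun y => χ (r • y)) (r • fderiv ℝ χ (r • x)) x := by
  have hχ : DifferentiableAt ℝ χ (r • x) := (χ.contDiff (n := 1)).differentiable one_ne_zero _
  have hcomp := hχ.hasFDerivAt.comp x ((hasFDerivAt_id x).const_smul r)
  rwa [ContinuousLinearMap.comp_smul, ContinuousLinearMap.comp_id] at hcomp

theorem tendsto_bump_smul (χ : ContDiffBump (0 : E)) {r : ℕ → ℝ} (hr : Tendsto r atTop (𝓝 0))
    (x : E) : Tendsto (fun n => χ (r n • x)) atTop (𝓝 1) := by
  have hscale : Tendsto (fun n => r n • x) atTop (𝓝 0) := by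
    simpa only [zero_smul] using hr.smul_const x
  refine tendsto_nhds_of_eventually_eq ?_
  filter_upwards [hscale.eventually (Metric.closedBall_mem_nhds 0 χ.rIn_pos)] with n hn
  exact χ.one_of_mem_closedBall hn

theorem norm_bump_le_one (χ : ContDiffBump (0 : E)) (x : E) : ‖χ x‖ ≤ 1 := by
  rw [Real.norm_of_nonneg χ.nonneg]
  exact χ.le_one

variable {F : Type*} [NormedAddCommGroup F] [NormedSpace ℝ F] [MeasurableSpace E] {μ : Measure E}

theorem eLpNorm_bump_smul_le (χ : ContDiffBump (0 : E)) (r : ℝ) (f : E → F)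
    (q : ℝ≥0∞) : eLpNorm (fun x => χ (r • x) • f x) q μ ≤ eLpNorm f q μ := by
  refine eLpNorm_mono fun x => ?_
  rw [norm_smul]
  exact mul_le_of_le_one_left (norm_nonneg _) (norm_bump_le_one χ _)

theorem eLpNorm_fderiv_bump_smul_le [BorelSpace E] {χ : ContDiffBump (0 : E)} {c : ℝ}
    (hc : ∀ x, ‖fderiv ℝ χ x‖ ≤ c) {f : E → F} (hf : ContDiff ℝ 1 f) (r : ℝ)
    {q : ℝ≥0∞} (hq : 1 ≤ q) : eLpNorm (fderiv ℝ fun x => χ (r • x) • f x) q μ ≤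
      eLpNorm (fderiv ℝ f) q μ + ENNReal.ofReal (‖r‖ * c) * eLpNorm f q μ := by
  have hpointwise (x : E) : ‖fderiv ℝ (fun x => χ (r • x) • f x) x‖ ≤
      ‖fderiv ℝ f x‖ + ‖(‖r‖ * c) • f x‖ := by
    have hc₀ : 0 ≤ c := (norm_nonneg _).trans (hc 0)
    have hsmul : HasFDerivAt (fun x => χ (r • x) • f x) _ x :=
      (hasFDerivAt_bump_smul χ r x).smul (hf.differentiable one_ne_zero x).hasFDerivAt
    rw [hsmul.fderiv]
    refine (norm_add_le _ _).trans (add_le_add ?_ ?_)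
    · rw [norm_smul]
      exact mul_le_of_le_one_left (norm_nonneg _) (norm_bump_le_one χ _)
    · rw [ContinuousLinearMap.norm_smulRight_apply, norm_smul, norm_smul,
        Real.norm_of_nonneg (mul_nonneg (norm_nonneg r) hc₀)]
      gcongr
      exact hc _
  calc eLpNorm (fderiv ℝ fun x => χ (r • x) • f x) q μ
      ≤ eLpNorm ((fun x => ‖fderiv ℝ f x‖) + fun x => ‖(‖r‖ * c) • f x‖) q μ :=
        eLpNorm_mono_real hpointwise
    _ ≤ eLpNorm (fun x => ‖fderiv ℝ f x‖) q μ + eLpNorm (fun x => ‖(‖r‖ * c) • f x‖) q μ :=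
        eLpNorm_add_le (hf.continuous_fderiv one_ne_zero).norm.aestronglyMeasurable
          (hf.continuous.const_smul _).norm.aestronglyMeasurable hq
    _ ≤ eLpNorm (fderiv ℝ f) q μ + ENNReal.ofReal (‖r‖ * c) * eLpNorm f q μ := by
        rw [eLpNorm_norm, eLpNorm_norm]
        gcongr
        refine eLpNorm_le_mul_eLpNorm_of_ae_le_mul (.of_forall fun x => ?_) q
        rw [norm_smul, Real.norm_of_nonneg
          (mul_nonneg (norm_nonneg r) ((norm_nonneg _).trans (hc 0)))]

end Cutoff

section GagliardoNirenberg

variable {E 𝕜 : Type*} [NormedAddCommGroup E] [NormedSpace ℝ E] [MeasurableSpace E] [BorelSpace E]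
  [FiniteDimensional ℝ E] [NormedField 𝕜] [NormedAlgebra ℝ 𝕜] {μ : Measure E} [μ.IsAddHaarMeasure]
  {p : NNReal}

theorem eLpNorm_sq_le_of_hasCompactSupport {f : E → 𝕜}
    (hf : ContDiff ℝ 1 f) (hsupp : HasCompactSupport f)
    (hp : (Module.finrank ℝ E : NNReal).HolderConjugate p) :
    eLpNorm (fun x => f x ^ 2) p μ ≤
      eLpNormLESNormFDerivOneConst μ p * (2 * (eLpNorm f 2 μ * eLpNorm (fderiv ℝ f) 2 μ)) := by
  have hderiv (x : E) : ‖fderiv ℝ (fun x => f x ^ 2) x‖ ≤ 2 * ‖(f • fderiv ℝ f) x‖ := by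
    rw [((hf.differentiable one_ne_zero x).hasFDerivAt.pow 2).fderiv]
    simp only [Nat.add_one_sub_one, pow_one, Pi.smul_apply', smul_assoc]
    exact norm_nsmul_le
  refine (eLpNorm_le_eLpNorm_fderiv_one μ (hf.pow 2) (hsupp.comp_left (zero_pow two_ne_zero))
    hp).trans ?_
  gcongr
  refine (eLpNorm_le_mul_eLpNorm_of_ae_le_mul (.of_forall hderiv) 1).trans ?_
  rw [ENNReal.ofReal_ofNat]
  gcongr
  exact eLpNorm_smul_le_mul_eLpNorm
    (hf.continuous_fderiv one_ne_zero).aestronglyMeasurable hf.continuous.aestronglyMeasurable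

theorem eLpNorm_sq_le_of_memLp {f : E → 𝕜}
    (hf : ContDiff ℝ 1 f) (hf2 : MemLp f 2 μ)
    (hp : (Module.finrank ℝ E : NNReal).HolderConjugate p) :
    eLpNorm (fun x => f x ^ 2) p μ ≤
      eLpNormLESNormFDerivOneConst μ p * (2 * (eLpNorm f 2 μ * eLpNorm (fderiv ℝ f) 2 μ)) := by
  let χ : ContDiffBump (0 : E) := default
  obtain ⟨c, hc⟩ := exists_norm_fderiv_bump_le χ
  let r (n : ℕ) : ℝ := 1 / (n + 1)
  have hr : Tendsto r atTop (𝓝 0) := tendsto_one_div_add_atTop_nhds_zero_nat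
  let g (n : ℕ) (x : E) : 𝕜 := χ (r n • x) • f x
  have hg (n : ℕ) : ContDiff ℝ 1 (g n) :=
    (χ.contDiff.comp (contDiff_const_smul (r n))).smul hf
  have hgsupp (n : ℕ) : HasCompactSupport (g n) :=
    (χ.hasCompactSupport.comp_homeomorph (Homeomorph.smulOfNeZero (r n)
      (by positivity))).smul_right
  have hlim (x : E) : Tendsto (fun n => g n x ^ 2) atTop (𝓝 (f x ^ 2)) := by
    simpa only [one_smul] using ((tendsto_bump_smul χ hr x).smul_const (f x)).pow 2
  have hbound (n : ℕ) : eLpNorm (fun x => g n x ^ 2) p μ ≤ eLpNormLESNormFDerivOneConst μ p *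
      (2 * (eLpNorm f 2 μ *
        (eLpNorm (fderiv ℝ f) 2 μ + ENNReal.ofReal (‖r n‖ * c) * eLpNorm f 2 μ))) := by
    refine (eLpNorm_sq_le_of_hasCompactSupport (hg n) (hgsupp n) hp).trans ?_
    gcongr
    · exact eLpNorm_bump_smul_le χ _ _ _
    · exact eLpNorm_fderiv_bump_smul_le hc hf _ one_le_two
  have herror : Tendsto (fun n => ENNReal.ofReal (‖r n‖ * c) * eLpNorm f 2 μ) atTop (𝓝 0) := by
    simpa using ENNReal.Tendsto.mul_const (ENNReal.tendsto_ofReal (hr.norm.mul_const c))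
      (.inr hf2.eLpNorm_ne_top)
  have hrhs := ENNReal.Tendsto.const_mul (a := (eLpNormLESNormFDerivOneConst μ p : ℝ≥0∞))
    (ENNReal.Tendsto.const_mul (a := 2) (ENNReal.Tendsto.const_mul (a := eLpNorm f 2 μ)
      (tendsto_const_nhds (x := eLpNorm (fderiv ℝ f) 2 μ) |>.add herror)
      (.inr hf2.eLpNorm_ne_top)) (.inr ENNReal.ofNat_ne_top)) (.inr ENNReal.coe_ne_top)
  rw [add_zero] at hrhs
  calc eLpNorm (fun x => f x ^ 2) p μ
      ≤ liminf (fun n => eLpNorm (fun x => g n x ^ 2) p μ) atTop :=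
        Lp.eLpNorm_lim_le_liminf_eLpNorm
          (fun n => ((hg n).pow 2).continuous.aestronglyMeasurable) _ (.of_forall hlim)
    _ ≤ _ := (liminf_le_liminf (.of_forall hbound)).trans_eq hrhs.liminf_eq

theorem opNorm_le_sum_norm_apply_single {ι F : Type*} [Fintype ι] [DecidableEq ι]
    [SeminormedAddCommGroup F] [NormedSpace ℝ F] (D : EuclideanSpace ℝ ι →L[ℝ] F) :
    ‖D‖ ≤ ∑ i, ‖D (EuclideanSpace.single i 1)‖ := by
  refine D.opNorm_le_bound (by positivity) fun x => ?_
  conv_lhs => rw [← (EuclideanSpace.basisFun ι ℝ).sum_repr x]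
  rw [map_sum, Finset.sum_mul]
  refine norm_sum_le_of_le _ fun i _ => ?_
  rw [map_smul, norm_smul, mul_comm, EuclideanSpace.basisFun_apply, EuclideanSpace.basisFun_repr]
  gcongr
  exact PiLp.norm_apply_le x i

theorem eLpNorm_fderiv_schwartz_le (φ : 𝓢(Plane, ℂ)) :
    eLpNorm (fderiv ℝ φ) 2 volume ≤ ∑ i, ‖grad (ofSchwartz φ) i‖ₑ := by
  let pderiv (i : Fin 2) : 𝓢(Plane, ℂ) := ∂_{(EuclideanSpace.single i (1 : ℝ) : Plane)} φ
  calc eLpNorm (fderiv ℝ φ) 2 volume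
      ≤ eLpNorm (∑ i, fun x => ‖pderiv i x‖) 2 volume := by
        refine eLpNorm_mono_real fun x => ?_
        rw [Finset.sum_apply]
        exact opNorm_le_sum_norm_apply_single _
    _ ≤ ∑ i, eLpNorm (fun x => ‖pderiv i x‖) 2 volume :=
        eLpNorm_sum_le (fun i _ => (pderiv i).continuous.norm.aestronglyMeasurable) one_le_two
    _ = ∑ i, ‖grad (ofSchwartz φ) i‖ₑ := by
        refine Finset.sum_congr rfl fun i _ => ?_
        rw [eLpNorm_norm, grad_ofSchwartz, Lp.enorm_def]
        exact eLpNorm_congr_ae ((pderiv i).coeFn_toLp 2).symm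

theorem exists_eLpNorm_schwartz_sq_le :
    ∃ K : NNReal, ∀ φ : 𝓢(Plane, ℂ), eLpNorm (fun x => φ x ^ 2) 2 volume ≤
      K * (‖toL2 (ofSchwartz φ)‖ₑ * ∑ i, ‖grad (ofSchwartz φ) i‖ₑ) := by
  have hconj : (Module.finrank ℝ Plane : NNReal).HolderConjugate 2 := by
    rw [finrank_euclideanSpace_fin]
    exact_mod_cast NNReal.HolderConjugate.two_two
  obtain ⟨K, hK⟩ : ∃ K : NNReal, ∀ φ : 𝓢(Plane, ℂ), eLpNorm (fun x => φ x ^ 2) 2 volume ≤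
      K * (2 * (eLpNorm φ 2 volume * eLpNorm (fderiv ℝ φ) 2 volume)) :=
    ⟨_, fun φ => eLpNorm_sq_le_of_memLp (φ.smooth 1) (φ.memLp 2) hconj⟩
  refine ⟨K * 2, fun φ => (hK φ).trans ?_⟩
  have hL2 : eLpNorm φ 2 volume = ‖toL2 (ofSchwartz φ)‖ₑ := by
    rw [toL2_ofSchwartz, Lp.enorm_def]
    exact eLpNorm_congr_ae (φ.coeFn_toLp 2).symm
  rw [hL2, ENNReal.coe_mul, ENNReal.coe_ofNat, mul_assoc]
  gcongr
  exact eLpNorm_fderiv_schwartz_le φ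

theorem sum_enorm_grad_ne_top (u : H1) : ∑ i, ‖grad u i‖ₑ ≠ ∞ :=
  ENNReal.sum_ne_top.2 fun _ _ => enorm_ne_top

theorem exists_seq_schwartz_tendsto (u : H1) : ∃ φ : ℕ → 𝓢(Plane, ℂ),
    Tendsto (fun n => ofSchwartz (φ n)) atTop (𝓝 u) ∧
      ∀ᵐ x, Tendsto (fun n => φ n x) atTop (𝓝 (toL2 u x)) := by
  obtain ⟨w, hw, hwu⟩ := mem_closure_iff_seq_limit.1 (denseRange_ofSchwartz u)
  choose φ hφ using hw
  obtain rfl : (fun n => ofSchwartz (φ n)) = w := funext hφ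
  have hL2 : Tendsto (fun n => toL2 (ofSchwartz (φ n))) atTop (𝓝 (toL2 u)) :=
    (toL2CLM.continuous.tendsto u).comp hwu
  obtain ⟨ns, hns, hae⟩ := (tendstoInMeasure_of_tendsto_Lp hL2).exists_seq_tendsto_ae
  refine ⟨φ ∘ ns, hwu.comp hns.tendsto_atTop, ?_⟩
  filter_upwards [hae, ae_all_iff.2 fun k => (φ (ns k)).coeFn_toLp 2 volume] with x hx hφx
  exact hx.congr fun k => by rw [toL2_ofSchwartz, hφx k, Function.comp_apply]

theorem exists_eLpNorm_toL2_sq_le :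
    ∃ K : NNReal, ∀ u : H1, eLpNorm (fun x => toL2 u x ^ 2) 2 volume ≤
      K * (‖toL2 u‖ₑ * ∑ i, ‖grad u i‖ₑ) := by
  obtain ⟨K, hK⟩ := exists_eLpNorm_schwartz_sq_le
  refine ⟨K, fun u => ?_⟩
  obtain ⟨φ, hφ, hae⟩ := exists_seq_schwartz_tendsto u
  have hgrad (i : Fin 2) : Tendsto (fun n => grad (ofSchwartz (φ n)) i) atTop (𝓝 (grad u i)) :=
    (((PiLp.proj 2 (fun _ : Fin 2 => L2) i : _ →L[ℂ] L2) ∘L gradCLM).continuous.tendsto u).comp hφ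
  have hrhs : Tendsto (fun n => K * (‖toL2 (ofSchwartz (φ n))‖ₑ *
      ∑ i, ‖grad (ofSchwartz (φ n)) i‖ₑ)) atTop (𝓝 (K * (‖toL2 u‖ₑ * ∑ i, ‖grad u i‖ₑ))) :=
    ENNReal.Tendsto.const_mul (ENNReal.Tendsto.mul ((toL2CLM.continuous.tendsto u).comp hφ).enorm
      (.inr (sum_enorm_grad_ne_top u)) (tendsto_finsetSum Finset.univ fun i _ => (hgrad i).enorm)
      (.inr enorm_ne_top)) (.inr ENNReal.coe_ne_top)
  calc eLpNorm (fun x => toL2 u x ^ 2) 2 volume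
      ≤ liminf (fun n => eLpNorm (fun x => φ n x ^ 2) 2 volume) atTop :=
        Lp.eLpNorm_lim_le_liminf_eLpNorm (f := fun n x => φ n x ^ 2)
          (fun n => ((φ n).continuous.pow 2).aestronglyMeasurable) (fun x => toL2 u x ^ 2)
          (hae.mono fun x hx => hx.pow 2)
    _ ≤ _ := (liminf_le_liminf (.of_forall fun n => hK (φ n))).trans_eq hrhs.liminf_eq

theorem eLpNorm_norm_sq_eq {α : Type*} [MeasurableSpace α] (f : α → ℂ) (q : ℝ≥0∞)
    (ν : Measure α) :
    eLpNorm (fun x => ((‖f x‖ ^ 2 : ℝ) : ℂ)) q ν = eLpNorm (fun x => f x ^ 2) q ν :=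
  eLpNorm_congr_norm_ae (.of_forall fun x => by simp)

theorem memLp_norm_sq (u : H1) : MemLp (fun x => ((‖toL2 u x‖ ^ 2 : ℝ) : ℂ)) 2 volume := by
  refine ⟨Complex.continuous_ofReal.comp_aestronglyMeasurable
    ((Lp.aestronglyMeasurable (toL2 u)).norm.pow 2), ?_⟩
  obtain ⟨K, hK⟩ := exists_eLpNorm_toL2_sq_le
  rw [eLpNorm_norm_sq_eq]
  refine (hK u).trans_lt ?_
  finiteness [sum_enorm_grad_ne_top u]

theorem normSq_toL2 (u : H1) : normSq (toL2 u) = (memLp_norm_sq u).toLp _ :=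
  dif_pos (memLp_norm_sq u)

theorem coeFn_normSq (u : H1) :
    normSq (toL2 u) =ᵐ[volume] fun x => ((‖toL2 u x‖ ^ 2 : ℝ) : ℂ) := by
  rw [normSq_toL2]
  exact MemLp.coeFn_toLp _

theorem exists_norm_normSq_le :
    ∃ C, 0 < C ∧ ∀ u : H1, ‖normSq (toL2 u)‖ ≤ C * ‖grad u‖ * ‖toL2 u‖ := by
  obtain ⟨K, hK⟩ := exists_eLpNorm_toL2_sq_le
  refine ⟨K * 2 + 1, by positivity, fun u => ?_⟩
  have hgrad (i : Fin 2) : ‖grad u i‖ ≤ ‖grad u‖ := PiLp.norm_apply_le (grad u) i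
  calc ‖normSq (toL2 u)‖
      ≤ (K * (‖toL2 u‖ₑ * ∑ i, ‖grad u i‖ₑ) : ℝ≥0∞).toReal := by
        rw [normSq_toL2, Lp.norm_toLp, eLpNorm_norm_sq_eq]
        exact ENNReal.toReal_mono (by finiteness [sum_enorm_grad_ne_top u]) (hK u)
    _ = K * (‖toL2 u‖ * (‖grad u 0‖ + ‖grad u 1‖)) := by
        simp [Fin.sum_univ_two, ENNReal.toReal_add]
    _ ≤ K * (‖toL2 u‖ * (‖grad u‖ + ‖grad u‖)) := by gcongr <;> exact hgrad _
    _ ≤ (K * 2 + 1) * ‖grad u‖ * ‖toL2 u‖ := by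
        have : 0 ≤ ‖grad u‖ * ‖toL2 u‖ := by positivity
        linarith

end GagliardoNirenberg

section Compactness

variable {w : ℕ → H1} {B : ℝ}

theorem inner_shift_right (a : Plane) (f g : L2) :
    inner ℂ f (shift a g) = inner ℂ (shift (-a) f) g := by
  have hf : translationₗᵢ a (shift (-a) f) = f := by
    rw [← shift_eq_translationₗᵢ, shift_shift, add_neg_cancel, shift_zero]
  rw [← (translationₗᵢ a).inner_map_map (shift (-a) f), hf, shift_eq_translationₗᵢ]

theorem norm_grad_sq_eq_integral_fourier (u : H1) :
    ‖grad u‖ ^ 2 = ∫ ξ, (2 * Real.pi * ‖ξ‖) ^ 2 * ‖(𝓕 (toL2 u) : L2) ξ‖ ^ 2 := by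
  have hinner := inner_grad_eq_integral_fourier u u
  simp only [inner_self_eq_norm_sq_to_K, Complex.real_smul, Complex.coe_algebraMap,
    ← Complex.ofReal_pow, ← Complex.ofReal_mul] at hinner
  exact_mod_cast hinner.trans integral_complex_ofReal

theorem integrable_sq_norm_mul_norm_sq_fourier (u : H1) :
    Integrable fun ξ => (2 * Real.pi * ‖ξ‖) ^ 2 * ‖(𝓕 (toL2 u) : L2) ξ‖ ^ 2 := by
  refine (integrable_sq_norm_smul_inner_fourier u u).norm.congr (.of_forall fun ξ => ?_)
  simp only [norm_smul, norm_pow, Real.norm_eq_abs, sq_abs, inner_self_eq_norm_sq_to_K,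
    Complex.coe_algebraMap, Complex.norm_real, abs_norm]

/-- The projection of `H¹` onto the frequencies `|ξ| < N`. -/
def lowProj (N : ℝ) (u : H1) : H1 :=
  ⟨WithLp.toLp 2 (lowPass N (toL2 u), WithLp.toLp 2 fun i => lowPass N (grad u i)),
    fun i => lineDeriv_fourierMul (u.2 i) _⟩

theorem toL2_sub_lowProj (N : ℝ) (u : H1) :
    toL2 (u - lowProj N u) = toL2 u - lowPass N (toL2 u) := rfl

theorem norm_grad_sub_lowProj_le (N : ℝ) (u : H1) : ‖grad (u - lowProj N u)‖ ≤ ‖grad u‖ := by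
  rw [← sq_le_sq₀ (norm_nonneg _) (norm_nonneg _), PiLp.norm_sq_eq_of_L2, PiLp.norm_sq_eq_of_L2]
  gcongr with i
  exact norm_sub_lowPass_le N (grad u i)

theorem norm_toL2_sub_lowProj_le {N : ℝ} (hN : 0 ≤ N) (u : H1) :
    N * ‖toL2 (u - lowProj N u)‖ ≤ ‖grad u‖ := by
  rw [← sq_le_sq₀ (by positivity) (norm_nonneg _), toL2_sub_lowProj, mul_pow, ← Lp.norm_fourier_eq,
    norm_sq_eq_integral, norm_grad_sq_eq_integral_fourier, ← integral_const_mul]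
  refine integral_mono_ae ((integrable_norm_sq _).const_mul _)
    (integrable_sq_norm_mul_norm_sq_fourier u) ?_
  filter_upwards [coeFn_fourier_sub_lowPass N (toL2 u)] with ξ hξ
  rw [hξ]
  by_cases h : ξ ∈ Metric.ball 0 N
  · rw [Set.indicator_of_notMem (not_not_intro h), norm_zero, zero_pow two_ne_zero, mul_zero]
    positivity
  · rw [Set.indicator_of_mem h]
    have hNξ : N ≤ ‖ξ‖ := by simpa using h
    gcongr
    nlinarith [Real.pi_gt_three, norm_nonneg ξ]

theorem norm_sq_le_two_mul_add {E : Type*} [SeminormedAddCommGroup E] (a p : E) :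
    ‖a‖ ^ 2 ≤ 2 * ‖p‖ ^ 2 + 2 * ‖a - p‖ ^ 2 :=
  calc ‖a‖ ^ 2 ≤ (‖p‖ + ‖a - p‖) ^ 2 := by gcongr; exact norm_le_norm_add_norm_sub' a p
    _ ≤ 2 * (‖p‖ ^ 2 + ‖a - p‖ ^ 2) := add_sq_le
    _ = 2 * ‖p‖ ^ 2 + 2 * ‖a - p‖ ^ 2 := mul_add _ _ _

theorem norm_coeFn_normSq (u : H1) : ∀ᵐ x, ‖normSq (toL2 u) x‖ = ‖toL2 u x‖ ^ 2 := by
  filter_upwards [coeFn_normSq u] with x hx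
  rw [hx, Complex.norm_real, Real.norm_of_nonneg (by positivity)]

theorem norm_normSq_le_of_norm_inner_lowKernel_le {C : ℝ} (hC : 0 ≤ C)
    (hGN : ∀ u : H1, ‖normSq (toL2 u)‖ ≤ C * ‖grad u‖ * ‖toL2 u‖) {N S : ℝ} (hN : 0 < N) {u : H1}
    (hS : ∀ y, ‖inner ℂ (lowKernel N) (shift y (toL2 u))‖ ≤ S) :
    ‖normSq (toL2 u)‖ ≤ 2 * S * ‖toL2 u‖ + 2 * (C * ‖grad u‖ ^ 2 / N) := by
  have hS₀ : 0 ≤ S := (norm_nonneg _).trans (hS 0)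
  have hsplit : ‖normSq (toL2 u)‖ ≤
      2 * S * ‖lowPass N (toL2 u)‖ + 2 * ‖normSq (toL2 (u - lowProj N u))‖ := by
    refine norm_le_add_of_ae_le (by positivity) zero_le_two ?_
    filter_upwards [norm_coeFn_normSq u, norm_coeFn_normSq (u - lowProj N u),
      coeFn_lowPass_eq_inner N (toL2 u), Lp.coeFn_sub (toL2 u) (lowPass N (toL2 u))]
      with x hu hhigh hlow hsub
    have hlow_le : ‖lowPass N (toL2 u) x‖ ≤ S := by
      rw [hlow]
      exact hS x
    rw [hu, hhigh, toL2_sub_lowProj, hsub, Pi.sub_apply]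
    refine (norm_sq_le_two_mul_add _ (lowPass N (toL2 u) x)).trans ?_
    rw [pow_two ‖lowPass N (toL2 u) x‖, ← mul_assoc]
    gcongr
  have hhigh : ‖normSq (toL2 (u - lowProj N u))‖ ≤ C * ‖grad u‖ ^ 2 / N := by
    rw [le_div_iff₀ hN]
    calc ‖normSq (toL2 (u - lowProj N u))‖ * N
        ≤ C * ‖grad (u - lowProj N u)‖ * ‖toL2 (u - lowProj N u)‖ * N := by gcongr; exact hGN _
      _ = C * (‖grad (u - lowProj N u)‖ * (N * ‖toL2 (u - lowProj N u)‖)) := by ring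
      _ ≤ C * (‖grad u‖ * ‖grad u‖) := by
          gcongr
          · exact norm_grad_sub_lowProj_le N u
          · exact norm_toL2_sub_lowProj_le hN.le u
      _ = C * ‖grad u‖ ^ 2 := by ring
  refine hsplit.trans ?_
  gcongr
  exact norm_lowPass_le N _

theorem setIntegral_norm_sq_le {N : ℝ} (hN : 0 < N) (u : H1) (S : Set Plane) :
    ∫ x in S, ‖toL2 u x‖ ^ 2 ≤
      2 * (∫ y in S, ‖inner ℂ (lowKernel N) (shift y (toL2 u))‖ ^ 2) + 2 * (‖grad u‖ / N) ^ 2 := by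
  have hhigh : ∫ x in S, ‖(toL2 u - lowPass N (toL2 u)) x‖ ^ 2 ≤ (‖grad u‖ / N) ^ 2 :=
    calc ∫ x in S, ‖(toL2 u - lowPass N (toL2 u)) x‖ ^ 2
        ≤ ‖toL2 u - lowPass N (toL2 u)‖ ^ 2 := by
          rw [norm_sq_eq_integral]
          exact setIntegral_le_integral (integrable_norm_sq _) (.of_forall fun _ => by positivity)
      _ ≤ (‖grad u‖ / N) ^ 2 := by
          gcongr
          rw [le_div_iff₀' hN, ← toL2_sub_lowProj]
          exact norm_toL2_sub_lowProj_le hN.le u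
  have hlow : ∫ y in S, ‖inner ℂ (lowKernel N) (shift y (toL2 u))‖ ^ 2
      = ∫ y in S, ‖lowPass N (toL2 u) y‖ ^ 2 := by
    refine integral_congr_ae (ae_restrict_of_ae ?_)
    filter_upwards [coeFn_lowPass_eq_inner N (toL2 u)] with y hy
    rw [hy, shift_eq_translationₗᵢ]
  have hint (f : L2) : IntegrableOn (fun x => 2 * ‖f x‖ ^ 2) S :=
    ((integrable_norm_sq f).const_mul 2).integrableOn
  calc ∫ x in S, ‖toL2 u x‖ ^ 2
      ≤ ∫ x in S, (2 * ‖lowPass N (toL2 u) x‖ ^ 2 +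
          2 * ‖(toL2 u - lowPass N (toL2 u)) x‖ ^ 2) := by
        refine integral_mono_ae (integrable_norm_sq _).integrableOn
          ((hint _).add (hint _)) (ae_restrict_of_ae ?_)
        filter_upwards [Lp.coeFn_sub (toL2 u) (lowPass N (toL2 u))] with x hx
        rw [hx]
        exact norm_sq_le_two_mul_add _ _
    _ = 2 * (∫ y in S, ‖inner ℂ (lowKernel N) (shift y (toL2 u))‖ ^ 2) +
          2 * ∫ x in S, ‖(toL2 u - lowPass N (toL2 u)) x‖ ^ 2 := by
        rw [integral_add (hint _) (hint _), integral_const_mul, integral_const_mul, hlow]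
    _ ≤ _ := by gcongr

theorem tendsto_setIntegral_norm_sq_inner_shift {f : ℕ → L2} (hB : ∀ n, ‖f n‖ ≤ B)
    (hf : ∀ g : L2, Tendsto (fun n => inner ℂ g (f n)) atTop (𝓝 0)) (k : L2) {S : Set Plane}
    (hS : volume S < ∞) :
    Tendsto (fun n => ∫ y in S, ‖inner ℂ k (shift y (f n))‖ ^ 2) atTop (𝓝 0) := by
  have : IsFiniteMeasure ((volume : Measure Plane).restrict S) := isFiniteMeasure_restrict.2 hS.ne
  rw [← integral_zero Plane ℝ (μ := volume.restrict S)]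
  refine tendsto_integral_of_dominated_convergence (fun _ => (‖k‖ * B) ^ 2) (fun n => ?_)
    (integrable_const _) (fun n => .of_forall fun y => ?_) (.of_forall fun y => ?_)
  · exact ((continuous_const.inner (continuous_shift_left _)).norm.pow 2).aestronglyMeasurable
  · rw [Real.norm_of_nonneg (by positivity)]
    gcongr
    refine (norm_inner_le_norm _ _).trans ?_
    rw [shift_eq_translationₗᵢ, LinearIsometry.norm_map]
    gcongr
    exact hB n
  · simp only [inner_shift_right]
    simpa using (hf (shift (-y) k)).norm.pow 2

theorem tendsto_setIntegral_norm_sq (hB : ∀ n, ‖w n‖ ≤ B)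
    (hw : ∀ f : L2, Tendsto (fun n => inner ℂ f (toL2 (w n))) atTop (𝓝 0)) {S : Set Plane}
    (hS : volume S < ∞) :
    Tendsto (fun n => ∫ x in S, ‖toL2 (w n) x‖ ^ 2) atTop (𝓝 0) := by
  refine tendsto_order.2 ⟨fun ε hε => .of_forall fun n => hε.trans_le
    (integral_nonneg fun _ => by positivity), fun ε hε => ?_⟩
  obtain ⟨N, hNε, hN⟩ : ∃ N : ℝ, 2 * (B / N) ^ 2 < ε ∧ 0 < N := by
    have hhigh : Tendsto (fun N : ℝ => 2 * (B / N) ^ 2) atTop (𝓝 0) := by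
      simpa using (((tendsto_const_nhds (x := B)).div_atTop tendsto_id).pow 2).const_mul 2
    exact ((hhigh.eventually_lt_const hε).and (eventually_gt_atTop 0)).exists
  have hlow := ((tendsto_setIntegral_norm_sq_inner_shift (fun n => (norm_toL2_le _).trans (hB n))
    hw (lowKernel N) hS).const_mul 2).add_const (2 * (B / N) ^ 2)
  rw [mul_zero, zero_add] at hlow
  filter_upwards [hlow.eventually_lt_const hNε] with n hn
  refine (setIntegral_norm_sq_le hN (w n) S).trans_lt (lt_of_le_of_lt ?_ hn)
  gcongr
  exact (norm_grad_le _).trans (hB n)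

theorem exists_norm_normSq_le_of_norm_le (B : ℝ) :
    ∃ K, ∀ u : H1, ‖u‖ ≤ B → ‖normSq (toL2 u)‖ ≤ K := by
  obtain ⟨C, hC, hGN⟩ := exists_norm_normSq_le
  refine ⟨C * B * B, fun u hu => (hGN u).trans ?_⟩
  have hB : 0 ≤ B := (norm_nonneg _).trans hu
  gcongr
  · exact (norm_grad_le u).trans hu
  · exact (norm_toL2_le u).trans hu

theorem tendsto_inner_normSq (hB : ∀ n, ‖w n‖ ≤ B)
    (hw : ∀ f : L2, Tendsto (fun n => inner ℂ f (toL2 (w n))) atTop (𝓝 0)) (f : L2) :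
    Tendsto (fun n => inner ℂ f (normSq (toL2 (w n)))) atTop (𝓝 0) := by
  obtain ⟨K, hK⟩ := exists_norm_normSq_le_of_norm_le B
  refine Lp.induction (p := 2) ENNReal.ofNat_ne_top
    (motive := fun f : L2 => Tendsto (fun n => inner ℂ f (normSq (toL2 (w n)))) atTop (𝓝 0))
    (fun c s hs hμs => ?_) (fun f g hf hg _ hf₀ hg₀ => ?_)
    (isClosed_setOf_tendsto_inner_zero fun n => hK _ (hB n)) f
  · have hset (n : ℕ) : ∫ x in s, normSq (toL2 (w n)) x
        = ((∫ x in s, ‖toL2 (w n) x‖ ^ 2 : ℝ) : ℂ) :=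
      (integral_congr_ae (ae_restrict_of_ae (coeFn_normSq (w n)))).trans integral_complex_ofReal
    simp only [Lp.simpleFunc.coe_indicatorConst, L2.inner_indicatorConstLp_eq_inner_setIntegral,
      hset]
    simpa using ((Complex.continuous_ofReal.tendsto 0).comp
      (tendsto_setIntegral_norm_sq hB hw hμs)).mul_const (starRingEnd ℂ c)
  · simpa only [inner_add_left, add_zero] using hf₀.add hg₀

end Compactness

section WeakConvergenceH1

variable {w w' : ℕ → H1} {V V' : H1} {B : ℝ}

theorem weaklyConverges_iff : WeaklyConverges w V ↔
    ∀ ψ : H1, Tendsto (fun k => inner ℂ ψ (w k)) atTop (𝓝 (inner ℂ ψ V)) := by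
  refine ⟨fun h ψ => h (innerSL ℂ ψ), fun h ℓ => ?_⟩
  simpa only [InnerProductSpace.toDual_symm_apply (𝕜 := ℂ) (E := H1)] using
    h ((InnerProductSpace.toDual ℂ H1).symm ℓ)

theorem WeaklyConverges.inner_toL2 (h : WeaklyConverges w V) (f : L2) :
    Tendsto (fun k => inner ℂ f (toL2 (w k))) atTop (𝓝 (inner ℂ f (toL2 V))) :=
  h ((innerSL ℂ f).comp toL2CLM)

theorem WeaklyConverges.inner_grad (h : WeaklyConverges w V) (f : PiLp 2 fun _ : Fin 2 => L2) :
    Tendsto (fun k => inner ℂ f (grad (w k))) atTop (𝓝 (inner ℂ f (grad V))) :=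
  h ((innerSL ℂ f).comp gradCLM)

theorem WeaklyConverges.comp (h : WeaklyConverges w V) {φ : ℕ → ℕ} (hφ : StrictMono φ) :
    WeaklyConverges (fun k => w (φ k)) V :=
  fun ℓ => (h ℓ).comp hφ.tendsto_atTop

theorem WeaklyConverges.sub (h : WeaklyConverges w V) (h' : WeaklyConverges w' V') :
    WeaklyConverges (fun k => w k - w' k) (V - V') :=
  fun ℓ => by simpa only [map_sub] using (h ℓ).sub (h' ℓ)

theorem WeaklyConverges.add (h : WeaklyConverges w V) (h' : WeaklyConverges w' V') :
    WeaklyConverges (fun k => w k + w' k) (V + V') :=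
  fun ℓ => by simpa only [map_add] using (h ℓ).add (h' ℓ)

theorem WeaklyConverges.unique (h : WeaklyConverges w V) (h' : WeaklyConverges w V') : V = V' :=
  ext_inner_left ℂ fun ψ =>
    tendsto_nhds_unique (weaklyConverges_iff.1 h ψ) (weaklyConverges_iff.1 h' ψ)

theorem weaklyConverges_const (V : H1) : WeaklyConverges (fun _ => V) V :=
  fun _ => tendsto_const_nhds

theorem exists_weaklyConverges_subseq (hB : ∀ n, ‖w n‖ ≤ B) :
    ∃ (V : H1) (φ : ℕ → ℕ), StrictMono φ ∧ WeaklyConverges (fun k => w (φ k)) V := by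
  obtain ⟨V, φ, hφ, h⟩ := exists_tendsto_inner_subseq (𝕜 := ℂ) hB
  exact ⟨V, φ, hφ, weaklyConverges_iff.2 h⟩

end WeakConvergenceH1

section BrezisLieb

variable {w : ℕ → H1} {V : H1} {B : ℝ}

/-- The quartic functional `∫ T(|u|²) |u|² dx` of a bounded operator `T` on `L²`. Only the real
part is kept, as in `quartic`. -/
def quarticForm (T : L2 →L[ℂ] L2) (u : H1) : ℝ :=
  (inner ℂ (normSq (toL2 u)) (T (normSq (toL2 u)))).re

theorem sq_norm_sq_add_sub_sub_le {E : Type*} [NormedAddCommGroup E] [InnerProductSpace ℝ E]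
    (p q : E) : (‖p + q‖ ^ 2 - ‖q‖ ^ 2 - ‖p‖ ^ 2) ^ 2 ≤ 4 * (‖p‖ ^ 2 * ‖q‖ ^ 2) := by
  calc (‖p + q‖ ^ 2 - ‖q‖ ^ 2 - ‖p‖ ^ 2) ^ 2 = 4 * (inner ℝ p q) ^ 2 := by
        rw [norm_add_sq_real]
        ring
    _ ≤ 4 * (‖p‖ * ‖q‖) ^ 2 := by
        rw [← sq_abs (inner ℝ p q)]
        gcongr
        exact abs_real_inner_le_norm p q
    _ = 4 * (‖p‖ ^ 2 * ‖q‖ ^ 2) := by ring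

theorem norm_normSq_sub_normSq_sub_le (u V : H1) :
    ‖normSq (toL2 u) - normSq (toL2 (u - V)) - normSq (toL2 V)‖ ^ 2 ≤
      4 * (inner ℂ (normSq (toL2 V)) (normSq (toL2 (u - V)))).re := by
  have hint := (L2.integrable_inner (𝕜 := ℂ) (normSq (toL2 V)) (normSq (toL2 (u - V)))).re
  have hre : (inner ℂ (normSq (toL2 V)) (normSq (toL2 (u - V)))).re
      = ∫ x, RCLike.re (inner ℂ (normSq (toL2 V) x) (normSq (toL2 (u - V)) x)) := by
    rw [integral_re (L2.integrable_inner (𝕜 := ℂ) _ _), L2.inner_def]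
    rfl
  rw [hre, norm_sq_eq_integral, ← integral_const_mul]
  refine integral_mono_ae (integrable_norm_sq _) (hint.const_mul 4) ?_
  filter_upwards [coeFn_normSq u, coeFn_normSq V, coeFn_normSq (u - V),
    Lp.coeFn_sub (normSq (toL2 u) - normSq (toL2 (u - V))) (normSq (toL2 V)),
    Lp.coeFn_sub (normSq (toL2 u)) (normSq (toL2 (u - V))),
    Lp.coeFn_sub (toL2 u) (toL2 V)] with x hu hV huV hsub hsub' hdiff
  have hpoint := sq_norm_sq_add_sub_sub_le (toL2 V x) (toL2 u x - toL2 V x)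
  rw [add_sub_cancel] at hpoint
  rw [hsub, Pi.sub_apply, hsub', Pi.sub_apply, hu, hV, huV, toL2_sub, hdiff, Pi.sub_apply,
    RCLike.inner_apply, Complex.conj_ofReal, mul_comm (Complex.ofReal _)]
  norm_cast
  rw [Real.norm_eq_abs, sq_abs]
  exact hpoint

theorem WeaklyConverges.tendsto_inner_normSq_sub (h : WeaklyConverges w V) (hB : ∀ k, ‖w k‖ ≤ B)
    (f : L2) : Tendsto (fun k => inner ℂ f (normSq (toL2 (w k - V)))) atTop (𝓝 0) := by
  refine tendsto_inner_normSq (B := B + ‖V‖)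
    (fun k => (norm_sub_le _ _).trans (by gcongr; exact hB k)) (fun f => ?_) f
  have hsub := (h.sub (weaklyConverges_const V)).inner_toL2 f
  rwa [sub_self, toL2_zero, inner_zero_right] at hsub

theorem WeaklyConverges.tendsto_quarticForm_sub (h : WeaklyConverges w V) (hB : ∀ k, ‖w k‖ ≤ B)
    (T : L2 →L[ℂ] L2) :
    Tendsto (fun k => quarticForm T (w k) - quarticForm T (w k - V)) atTop
      (𝓝 (quarticForm T V)) := by
  have hw := h.tendsto_inner_normSq_sub hB
  obtain ⟨K, hK⟩ := exists_norm_normSq_le_of_norm_le (B + ‖V‖)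
  have hdiff : Tendsto (fun k => normSq (toL2 (w k)) - normSq (toL2 (w k - V))) atTop
      (𝓝 (normSq (toL2 V))) := by
    rw [tendsto_iff_norm_sub_tendsto_zero]
    have hcross : Tendsto (fun k => 4 * (inner ℂ (normSq (toL2 V)) (normSq (toL2 (w k - V)))).re)
        atTop (𝓝 0) := by
      simpa using ((Complex.continuous_re.tendsto _).comp (hw (normSq (toL2 V)))).const_mul 4
    simpa using (squeeze_zero (fun _ => sq_nonneg _)
      (fun k => norm_normSq_sub_normSq_sub_le (w k) V) hcross).sqrt
  have hform := (Complex.continuous_re.tendsto _).comp (tendsto_inner_clm_sub_inner_clm T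
    (fun k => hK _ ((norm_sub_le _ _).trans (by gcongr; exact hB k))) hw hdiff)
  simpa only [quarticForm, Function.comp_def, Complex.sub_re] using hform

end BrezisLieb

section QuarticForm

variable {T : L2 →L[ℂ] L2} {w : ℕ → H1} {ε B : ℝ}

theorem abs_quarticForm_le (T : L2 →L[ℂ] L2) (u : H1) :
    |quarticForm T u| ≤ ‖T‖ * ‖normSq (toL2 u)‖ ^ 2 :=
  calc |quarticForm T u| ≤ ‖normSq (toL2 u)‖ * ‖T (normSq (toL2 u))‖ :=
        (Complex.abs_re_le_norm _).trans (norm_inner_le_norm _ _)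
    _ ≤ ‖normSq (toL2 u)‖ * (‖T‖ * ‖normSq (toL2 u)‖) := by gcongr; exact T.le_opNorm _
    _ = ‖T‖ * ‖normSq (toL2 u)‖ ^ 2 := by ring

theorem normSq_translate (a : Plane) (u : H1) :
    normSq (toL2 (translate a u)) = shift a (normSq (toL2 u)) := by
  refine Lp.ext ?_
  filter_upwards [coeFn_normSq (translate a u), coeFn_shift a (normSq (toL2 u)),
    coeFn_shift a (toL2 u), (measurePreserving_add_right volume a).quasiMeasurePreserving.ae_eq
      (coeFn_normSq u)] with x hleft hright hu hsq
  rw [hleft, hright, toL2_translate, hu]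
  exact hsq.symm

/-- An operator on `L²(ℝ²)` is translation invariant if it commutes with all translations. -/
def IsTranslationInvariant (T : L2 →L[ℂ] L2) : Prop :=
  ∀ (a : Plane) (f : L2), T (shift a f) = shift a (T f)

theorem quarticForm_translate (hT : IsTranslationInvariant T) (a : Plane) (u : H1) :
    quarticForm T (translate a u) = quarticForm T u := by
  rw [quarticForm, normSq_translate, hT, shift_eq_translationₗᵢ, shift_eq_translationₗᵢ,
    LinearIsometry.inner_map_map, quarticForm]

/-- The constants `C` with `∫ T(|u|²) |u|² dx ≤ C ‖∇u‖₂² ‖u‖₂²` for all `u ∈ H¹(ℝ²)`. -/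
def quarticConstants (T : L2 →L[ℂ] L2) : Set ℝ :=
  {C | ∀ u : H1, quarticForm T u ≤ C * (‖grad u‖ ^ 2 * ‖toL2 u‖ ^ 2)}

theorem quarticConstants_nonempty (T : L2 →L[ℂ] L2) : (quarticConstants T).Nonempty := by
  obtain ⟨C, -, hGN⟩ := exists_norm_normSq_le
  refine ⟨‖T‖ * C ^ 2, fun u => (le_abs_self _).trans ((abs_quarticForm_le T u).trans ?_)⟩
  calc ‖T‖ * ‖normSq (toL2 u)‖ ^ 2 ≤ ‖T‖ * (C * ‖grad u‖ * ‖toL2 u‖) ^ 2 := by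
        gcongr
        exact hGN u
    _ = ‖T‖ * C ^ 2 * (‖grad u‖ ^ 2 * ‖toL2 u‖ ^ 2) := by ring

theorem pos_of_mem_quarticConstants {C : ℝ} {u : H1} (hu : 0 < quarticForm T u)
    (hC : C ∈ quarticConstants T) : 0 < C :=
  pos_of_forall_le_mul (fun _ => by positivity) hu hC

theorem isLeast_quarticConstants {u : H1} (hu : 0 < quarticForm T u) :
    IsLeast (quarticConstants T) (sInf (quarticConstants T)) :=
  isLeast_sInf_setOf_forall_le_mul (fun _ => by positivity) hu
    (quarticConstants_nonempty T).some_mem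

theorem exists_lt_norm_inner_lowKernel (T : L2 →L[ℂ] L2) (hε : 0 < ε) (B : ℝ) :
    ∃ N S : ℝ, 0 < S ∧ ∀ u : H1, ‖u‖ ≤ B → ε ≤ quarticForm T u →
      ∃ y, S < ‖inner ℂ (lowKernel N) (shift y (toL2 u))‖ := by
  obtain ⟨C, hC, hGN⟩ := exists_norm_normSq_le
  obtain ⟨η, hη, hηε⟩ : ∃ η, 0 < η ∧ ‖T‖ * η ^ 2 < ε := by
    have hlim : Tendsto (fun η : ℝ => ‖T‖ * η ^ 2) (𝓝[>] 0) (𝓝 0) :=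
      tendsto_nhdsWithin_of_tendsto_nhds (Continuous.tendsto' (by fun_prop) _ _ (by simp))
    exact (eventually_mem_nhdsWithin.and (hlim.eventually_lt_const hε)).exists
  set D := |B| + 1
  have hD : 0 < D := by positivity
  refine ⟨4 * C * D ^ 2 / η, η / (4 * D), by positivity, fun u hu hQ => ?_⟩
  by_contra! hS
  have huD : ‖u‖ ≤ D := hu.trans ((le_abs_self B).trans (lt_add_one _).le)
  have hnormSq : ‖normSq (toL2 u)‖ ≤ η :=
    calc ‖normSq (toL2 u)‖
        ≤ 2 * (η / (4 * D)) * ‖toL2 u‖ + 2 * (C * ‖grad u‖ ^ 2 / (4 * C * D ^ 2 / η)) :=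
          norm_normSq_le_of_norm_inner_lowKernel_le hC.le hGN (by positivity) hS
      _ ≤ 2 * (η / (4 * D)) * D + 2 * (C * D ^ 2 / (4 * C * D ^ 2 / η)) := by
          gcongr
          · exact (norm_toL2_le u).trans huD
          · exact (norm_grad_le u).trans huD
      _ = η := by field_simp; norm_num
  have hQη : quarticForm T u ≤ ‖T‖ * η ^ 2 :=
    (le_abs_self _).trans ((abs_quarticForm_le T u).trans (by gcongr))
  linarith

theorem exists_translate_weaklyConverges (T : L2 →L[ℂ] L2) (hε : 0 < ε) (B : ℝ) :
    ∃ δ, 0 < δ ∧ ∀ v : ℕ → H1, (∀ᶠ n in atTop, ‖v n‖ ≤ B ∧ ε ≤ quarticForm T (v n)) →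
      ∃ (φ : ℕ → ℕ) (y : ℕ → Plane) (V : H1), StrictMono φ ∧
        WeaklyConverges (fun k => translate (y k) (v (φ k))) V ∧ δ ≤ ‖toL2 V‖ ^ 2 := by
  obtain ⟨N, S, hS, hconc⟩ := exists_lt_norm_inner_lowKernel T hε B
  refine ⟨(S / (‖(lowKernel N : L2)‖ + 1)) ^ 2, by positivity, fun v hv => ?_⟩
  obtain ⟨n₀, hn₀⟩ := eventually_atTop.1 hv
  have hv' (n : ℕ) := hn₀ (n + n₀) (Nat.le_add_left n₀ n)
  choose y hy using fun n => hconc (v (n + n₀)) (hv' n).1 (hv' n).2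
  obtain ⟨V, φ, hφ, hV⟩ := exists_weaklyConverges_subseq
    (w := fun n => translate (y n) (v (n + n₀))) (B := B)
    fun n => (norm_translate _ _).trans_le (hv' n).1
  refine ⟨fun k => φ k + n₀, fun k => y (φ k), V, hφ.add_const n₀, hV, ?_⟩
  have hSV : S ≤ ‖inner ℂ (lowKernel N) (toL2 V)‖ :=
    ge_of_tendsto' (hV.inner_toL2 (lowKernel N)).norm fun k => (hy (φ k)).le
  gcongr
  rw [div_le_iff₀' (by positivity)]
  exact hSV.trans ((norm_inner_le_norm _ _).trans (by gcongr; linarith))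

end QuarticForm

section TranslatedLimits

variable {v w : ℕ → H1} {V W : H1} {B : ℝ} {φ : ℕ → ℕ} {y z : ℕ → Plane}

theorem weaklyConverges_zero_iff : WeaklyConverges w 0 ↔
    ∀ ψ : H1, Tendsto (fun k => inner ℂ ψ (w k)) atTop (𝓝 0) := by
  have hzero (ψ : H1) : inner ℂ ψ (0 : H1) = 0 := inner_zero_right (𝕜 := ℂ) (E := H1) ψ
  simp only [weaklyConverges_iff, hzero]

theorem weaklyConverges_translate_of_tendsto_cocompact (V : H1)
    (hy : Tendsto y atTop (cocompact Plane)) :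
    WeaklyConverges (fun k => translate (y k) V) 0 := by
  refine weaklyConverges_zero_iff.2 fun ψ => ?_
  have hlim (f g : L2) : Tendsto (fun k => inner ℂ f (shift (y k) g)) atTop (𝓝 0) :=
    (tendsto_inner_translationₗᵢ_cocompact f g).comp hy
  simp only [inner_eq_add, PiLp.inner_apply, toL2_translate, grad_translate]
  simpa using (hlim (toL2 ψ) (toL2 V)).add
    (tendsto_finsetSum Finset.univ fun i _ => hlim (grad ψ i) (grad V i))

theorem WeaklyConverges.translate_zero (hw : WeaklyConverges w 0) (hB : ∀ k, ‖w k‖ ≤ B)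
    {z₀ : Plane} (hz : Tendsto z atTop (𝓝 z₀)) :
    WeaklyConverges (fun k => translate (z k) (w k)) 0 := by
  refine weaklyConverges_zero_iff.2 fun ψ => ?_
  simp only [inner_translate_right]
  exact tendsto_inner_of_tendsto_left (𝕜 := ℂ) (E := H1)
    (((continuous_translate_left ψ).tendsto (-z₀)).comp hz.neg) hB (weaklyConverges_zero_iff.1 hw _)

/-- `W` is a translated limit of `v` if it is the weak limit of translates of a subsequence of `v`.
These are the candidates for the profiles of `v`. -/
def IsTranslatedLimit (v : ℕ → H1) (W : H1) : Prop :=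
  ∃ (φ : ℕ → ℕ) (y : ℕ → Plane), StrictMono φ ∧
    WeaklyConverges (fun k => translate (y k) (v (φ k))) W

theorem IsTranslatedLimit.of_comp (hφ : StrictMono φ)
    (h : IsTranslatedLimit (fun k => v (φ k)) W) : IsTranslatedLimit v W := by
  obtain ⟨ψ, y, hψ, hW⟩ := h
  exact ⟨fun k => φ (ψ k), y, hφ.comp hψ, hW⟩

theorem norm_translate_sub_le (hB : ∀ n, ‖v n‖ ≤ B) (φ : ℕ → ℕ) (y : ℕ → Plane) (V : H1) (k : ℕ) :
    ‖translate (y k) (v (φ k)) - V‖ ≤ B + ‖V‖ := by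
  refine (norm_sub_le _ _).trans ?_
  rw [norm_translate]
  gcongr
  exact hB _

-- A further translation by `z k` converging to `z₀` kills the remainder, while one escaping to
-- infinity kills `V`, so that the remainder and `v` itself have the same limit.
theorem IsTranslatedLimit.of_sub (hB : ∀ n, ‖v n‖ ≤ B) (hφ : StrictMono φ)
    (hV : WeaklyConverges (fun k => translate (y k) (v (φ k))) V)
    (hW : IsTranslatedLimit (fun k => translate (y k) (v (φ k)) - V) W) :
    W = 0 ∨ IsTranslatedLimit v W := by
  obtain ⟨ψ, z, hψ, hW⟩ := hW
  rcases exists_subseq_tendsto_or_tendsto_cocompact z with ⟨z₀, σ, hσ, hz⟩ | hz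
  · have hrem : WeaklyConverges (fun k => translate (y k) (v (φ k)) - V) 0 := by
      simpa only [sub_self] using hV.sub (weaklyConverges_const V)
    exact .inl ((hW.comp hσ).unique ((hrem.comp (hψ.comp hσ)).translate_zero
      (fun k => norm_translate_sub_le hB φ y V _) hz))
  · refine .inr ⟨fun k => φ (ψ k), fun k => z k + y (ψ k), hφ.comp hψ, ?_⟩
    have hsum := hW.add (weaklyConverges_translate_of_tendsto_cocompact V hz)
    simpa only [translate_sub, translate_translate, sub_add_cancel, add_zero] using hsum

end TranslatedLimits

section Profiles

variable {T : L2 →L[ℂ] L2} {v : ℕ → H1} {V : H1} {s g q c A ε B : ℝ} {φ : ℕ → ℕ} {y : ℕ → Plane}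

/-- A bounded sequence in `H¹` whose mass, Dirichlet energy and quartic functional converge to
`s`, `g` and `q`. -/
structure HasLimits (T : L2 →L[ℂ] L2) (v : ℕ → H1) (s g q : ℝ) : Prop where
  bounded : ∃ B, ∀ n, ‖v n‖ ≤ B
  mass : Tendsto (fun n => ‖toL2 (v n)‖ ^ 2) atTop (𝓝 s)
  energy : Tendsto (fun n => ‖grad (v n)‖ ^ 2) atTop (𝓝 g)
  quartic : Tendsto (fun n => quarticForm T (v n)) atTop (𝓝 q)

namespace HasLimits

theorem mass_nonneg (h : HasLimits T v s g q) : 0 ≤ s :=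
  ge_of_tendsto' h.mass fun _ => by positivity

theorem energy_nonneg (h : HasLimits T v s g q) : 0 ≤ g :=
  ge_of_tendsto' h.energy fun _ => by positivity

theorem eventually_norm_le (h : HasLimits T v s g q) (hB : 0 ≤ B) (hsg : s + g < B ^ 2) :
    ∀ᶠ n in atTop, ‖v n‖ ≤ B := by
  filter_upwards [(h.mass.add h.energy).eventually_lt_const hsg] with n hn
  rw [← norm_sq_eq_add] at hn
  exact le_of_sq_le_sq hn.le hB

theorem translate_sub (hT : IsTranslationInvariant T) (h : HasLimits T v s g q)
    (hφ : StrictMono φ) (hV : WeaklyConverges (fun k => translate (y k) (v (φ k))) V) :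
    HasLimits T (fun k => translate (y k) (v (φ k)) - V)
      (s - ‖toL2 V‖ ^ 2) (g - ‖grad V‖ ^ 2) (q - quarticForm T V) := by
  obtain ⟨B, hB⟩ := h.bounded
  refine ⟨⟨B + ‖V‖, norm_translate_sub_le hB φ y V⟩, ?_, ?_, ?_⟩
  · simp only [toL2_sub]
    refine tendsto_norm_sub_sq (hV.inner_toL2 _) ?_
    simpa only [norm_toL2_translate, Function.comp_def] using h.mass.comp hφ.tendsto_atTop
  · simp only [grad_sub]
    refine tendsto_norm_sub_sq (hV.inner_grad _) ?_
    simpa only [norm_grad_translate, Function.comp_def] using h.energy.comp hφ.tendsto_atTop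
  · have hsplit := hV.tendsto_quarticForm_sub (fun k => (norm_translate _ _).trans_le (hB _)) T
    simpa [Function.comp_def, quarticForm_translate hT] using
      (h.quartic.comp hφ.tendsto_atTop).sub hsplit

-- The remainder has lost the mass `‖V‖² ≥ δ`, so that `N` extractions exhaust a mass `s < N δ`.
theorem exists_le_add (hT : IsTranslationInvariant T) (hc : c ∈ quarticConstants T) (hc₀ : 0 ≤ c)
    (hA : 0 ≤ A) (hε : 0 < ε) (hB : 0 ≤ B) :
    ∃ δ, 0 < δ ∧ ∀ (N : ℕ) (v : ℕ → H1) (s g q : ℝ), HasLimits T v s g q → s + g < B ^ 2 →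
      s < N * δ → (∀ W, IsTranslatedLimit v W → ‖toL2 W‖ ^ 2 ≤ A) → q ≤ c * A * g + ε := by
  obtain ⟨δ, hδ, hextract⟩ := exists_translate_weaklyConverges T hε B
  refine ⟨δ, hδ, fun N => ?_⟩
  induction N with
  | zero =>
    intro v s g q h _ hs
    rw [Nat.cast_zero, zero_mul] at hs
    exact absurd h.mass_nonneg hs.not_ge
  | succ N ih =>
    intro v s g q h hsg hs hW
    have hg := h.energy_nonneg
    by_contra! hlt
    have hεq : ε < q := (le_add_of_nonneg_left (by positivity)).trans_lt hlt
    obtain ⟨φ, y, V, hφ, hV, hδV⟩ := hextract v <|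
      (h.eventually_norm_le hB hsg).and ((h.quartic.eventually_const_lt hεq).mono fun _ => le_of_lt)
    obtain ⟨R, hR⟩ := h.bounded
    have hrem : q - quarticForm T V ≤ c * A * (g - ‖grad V‖ ^ 2) + ε := by
      refine ih _ _ _ _ (h.translate_sub hT hφ hV)
        (by linarith [sq_nonneg ‖toL2 V‖, sq_nonneg ‖grad V‖])
        (by push_cast at hs; linarith) fun W hW' => ?_
      rcases IsTranslatedLimit.of_sub hR hφ hV hW' with rfl | hW'
      · simpa [toL2_zero] using hA
      · exact hW W hW'
    have hprofile : quarticForm T V ≤ c * A * ‖grad V‖ ^ 2 :=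
      calc quarticForm T V ≤ c * (‖grad V‖ ^ 2 * ‖toL2 V‖ ^ 2) := hc V
        _ ≤ c * (‖grad V‖ ^ 2 * A) := by gcongr; exact hW V ⟨φ, y, hφ, hV⟩
        _ = c * A * ‖grad V‖ ^ 2 := by ring
    linarith

theorem quartic_le (hT : IsTranslationInvariant T) (hc : c ∈ quarticConstants T) (hc₀ : 0 ≤ c)
    (hA : 0 ≤ A) (h : HasLimits T v s g q)
    (hW : ∀ W, IsTranslatedLimit v W → ‖toL2 W‖ ^ 2 ≤ A) : q ≤ c * A * g := by
  refine le_of_forall_pos_le_add fun ε hε => ?_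
  obtain ⟨B, hsg, hB⟩ : ∃ B : ℝ, s + g < B ^ 2 ∧ 0 ≤ B :=
    (((tendsto_pow_atTop two_ne_zero).eventually_gt_atTop _).and (eventually_ge_atTop 0)).exists
  obtain ⟨δ, hδ, hbound⟩ := exists_le_add hT hc hc₀ hA hε hB
  obtain ⟨N, hN⟩ := exists_nat_gt (s / δ)
  exact hbound N v s g q h hsg ((div_lt_iff₀ hδ).1 hN) hW

end HasLimits

theorem norm_grad_pos {u : H1} (hu : toL2 u ≠ 0) : 0 < ‖grad u‖ := by
  obtain ⟨C, -, hGN⟩ := exists_norm_normSq_le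
  refine (norm_nonneg _).lt_of_ne' fun hgrad => hu ?_
  have hnormSq := hGN u
  rw [hgrad, mul_zero, zero_mul, norm_le_zero_iff] at hnormSq
  refine (Lp.eq_zero_iff_ae_eq_zero).2 ?_
  filter_upwards [norm_coeFn_normSq u, Lp.coeFn_zero ℂ 2 (volume : Measure Plane)] with x hx hzero
  rw [hnormSq, hzero] at hx
  simpa using hx.symm

theorem HasLimits.exists_isTranslatedLimit (hT : IsTranslationInvariant T)
    (hc : c ∈ quarticConstants T) (h : HasLimits T v s g q) (hq : 0 < q) :
    ∃ V, IsTranslatedLimit v V ∧ q ≤ c * g * ‖toL2 V‖ ^ 2 := by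
  by_contra! hlt
  obtain ⟨n, hn⟩ := (h.quartic.eventually_const_lt hq).exists
  have hc₀ := pos_of_mem_quarticConstants hn hc
  obtain ⟨B, hB⟩ := h.bounded
  obtain ⟨δ, hδ, hextract⟩ := exists_translate_weaklyConverges T (half_pos hq) B
  obtain ⟨φ, y, V, hφ, hV, hδV⟩ := hextract v <|
    (h.quartic.eventually_const_lt (half_lt_self hq)).mono fun n hn => ⟨hB n, hn.le⟩
  have hrem := h.translate_sub hT hφ hV
  have hgV : 0 < ‖grad V‖ := norm_grad_pos fun hzero => by
    rw [hzero, norm_zero, zero_pow two_ne_zero] at hδV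
    exact hδ.not_ge hδV
  have hg : 0 < g := by linarith [hrem.energy_nonneg, pow_pos hgV 2]
  have hlt' (W : H1) (hW : IsTranslatedLimit v W) : ‖toL2 W‖ ^ 2 < q / (c * g) :=
    (lt_div_iff₀' (by positivity)).2 (hlt W hW)
  have hremainder : q - quarticForm T V ≤ c * (q / (c * g)) * (g - ‖grad V‖ ^ 2) := by
    refine HasLimits.quartic_le hT hc hc₀.le (by positivity) hrem fun W hW => ?_
    rcases IsTranslatedLimit.of_sub hB hφ hV hW with rfl | hW
    · rw [toL2_zero, norm_zero, zero_pow two_ne_zero]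
      positivity
    · exact (hlt' W hW).le
  have hprofile : quarticForm T V < c * (q / (c * g)) * ‖grad V‖ ^ 2 :=
    calc quarticForm T V ≤ c * (‖grad V‖ ^ 2 * ‖toL2 V‖ ^ 2) := hc V
      _ < c * (‖grad V‖ ^ 2 * (q / (c * g))) := by gcongr; exact hlt' V ⟨φ, y, hφ, hV⟩
      _ = c * (q / (c * g)) * ‖grad V‖ ^ 2 := by ring
  have hcancel : c * (q / (c * g)) * g = q := by field_simp
  linarith

theorem exists_subseq_hasLimits (T : L2 →L[ℂ] L2) (hB : ∀ n, ‖v n‖ ≤ B) :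
    ∃ (φ : ℕ → ℕ) (s g : ℝ), StrictMono φ ∧ g ≤ limsup (fun n => ‖grad (v n)‖ ^ 2) atTop ∧
      HasLimits T (fun k => v (φ k)) s g (limsup (fun n => quarticForm T (v n)) atTop) := by
  obtain ⟨K, hK⟩ := exists_norm_normSq_le_of_norm_le B
  have hquartic (n : ℕ) : |quarticForm T (v n)| ≤ ‖T‖ * K ^ 2 :=
    (abs_quarticForm_le T _).trans (by gcongr; exact hK _ (hB n))
  have hbdd : IsBoundedUnder (· ≤ ·) atTop fun n => quarticForm T (v n) :=
    isBoundedUnder_of ⟨_, fun n => (abs_le.1 (hquartic n)).2⟩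
  have hcobdd : IsCoboundedUnder (· ≤ ·) atTop fun n => quarticForm T (v n) :=
    IsBoundedUnder.isCoboundedUnder_le (isBoundedUnder_of ⟨_, fun n => (abs_le.1 (hquartic n)).1⟩)
  obtain ⟨σ, hσ, hσlim⟩ := (MapClusterPt.limsup hcobdd hbdd).tendsto_subseq
  have hmem (k : ℕ) : (‖toL2 (v (σ k))‖ ^ 2, ‖grad (v (σ k))‖ ^ 2) ∈
      Set.Icc ((0, 0) : ℝ × ℝ) (B ^ 2, B ^ 2) := by
    refine ⟨⟨by positivity, by positivity⟩, ?_, ?_⟩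
    · exact pow_le_pow_left₀ (norm_nonneg _) ((norm_toL2_le _).trans (hB _)) 2
    · exact pow_le_pow_left₀ (norm_nonneg _) ((norm_grad_le _).trans (hB _)) 2
  obtain ⟨⟨s, g⟩, -, τ, hτ, hτlim⟩ := isCompact_Icc.tendsto_subseq hmem
  have henergy : Tendsto (fun k => ‖grad (v (σ (τ k)))‖ ^ 2) atTop (𝓝 g) :=
    (continuous_snd.tendsto _).comp hτlim
  refine ⟨fun k => σ (τ k), s, g, hσ.comp hτ, ?_, ⟨B, fun k => hB _⟩,
    (continuous_fst.tendsto _).comp hτlim, henergy, hσlim.comp hτ.tendsto_atTop⟩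
  exact (MapClusterPt.of_comp (hσ.comp hτ).tendsto_atTop henergy.mapClusterPt).le_limsup
    (isBoundedUnder_of ⟨B ^ 2, fun n =>
      pow_le_pow_left₀ (norm_nonneg _) ((norm_grad_le _).trans (hB n)) 2⟩)

end Profiles

section Operator

/-- The operator `𝓛 = ν I + γ 𝓑` as a bounded operator on `L²`. -/
def opLCLM (ν γ : ℝ) : L2 →L[ℂ] L2 :=
  (ν : ℂ) • ContinuousLinearMap.id ℂ L2 + (γ : ℂ) • fourierMul (memLp_symbolB.toLp symbolB)

theorem opLCLM_apply (ν γ : ℝ) (f : L2) : opLCLM ν γ f = opL ν γ f := rfl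

theorem isTranslationInvariant_opLCLM (ν γ : ℝ) : IsTranslationInvariant (opLCLM ν γ) := by
  intro a f
  simp only [opLCLM, add_apply, smul_apply,
    ContinuousLinearMap.id_apply, shift_eq_translationₗᵢ, fourierMul_translationₗᵢ, map_add,
    map_smul]

theorem quartic_eq_quarticForm (ν γ : ℝ) : quartic ν γ = quarticForm (opLCLM ν γ) := by
  ext u
  rw [quartic, quarticForm, L2.inner_def, opLCLM_apply]
  congr 1
  refine integral_congr_ae ?_
  filter_upwards [coeFn_normSq u] with x hx
  rw [RCLike.inner_apply, hx, Complex.conj_ofReal]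

theorem admissibleConstants_eq_quarticConstants (ν γ : ℝ) :
    admissibleConstants ν γ = quarticConstants (opLCLM ν γ) := by
  simp only [admissibleConstants, quarticConstants, quartic_eq_quarticForm, mul_assoc]

end Operator

end DaveyStewartson

end

theorem theorem5_general
    (T : DaveyStewartson.L2 →L[ℂ] DaveyStewartson.L2)
    (hT : DaveyStewartson.IsTranslationInvariant T)
    (v : ℕ → DaveyStewartson.H1) (hbdd : ∃ B : ℝ, ∀ n, ‖v n‖ ≤ B)
    (m M : ℝ) (hm : 0 < m) (hM : 0 < M)
    (hgrad : limsup (fun n => ‖DaveyStewartson.grad (v n)‖ ^ 2) atTop ≤ M ^ 2)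
    (hquartic : m ^ 4 ≤ limsup (fun n => DaveyStewartson.quarticForm T (v n)) atTop) :
    IsLeast (DaveyStewartson.quarticConstants T) (sInf (DaveyStewartson.quarticConstants T)) ∧
    0 < sInf (DaveyStewartson.quarticConstants T) ∧
    ∃ (x : ℕ → DaveyStewartson.Plane) (φ : ℕ → ℕ) (V : DaveyStewartson.H1), StrictMono φ ∧
      DaveyStewartson.WeaklyConverges (fun k => DaveyStewartson.translate (x (φ k)) (v (φ k))) V ∧
      m ^ 2 / (M * √(sInf (DaveyStewartson.quarticConstants T))) ≤ ‖DaveyStewartson.toL2 V‖ := by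
  obtain ⟨B, hB⟩ := hbdd
  obtain ⟨σ, s, g, hσ, hg, hlim⟩ := DaveyStewartson.exists_subseq_hasLimits T hB
  have hq := (pow_pos hm 4).trans_le hquartic
  obtain ⟨k, hk⟩ := (hlim.quartic.eventually_const_lt hq).exists
  have hC := DaveyStewartson.isLeast_quarticConstants hk
  have hC₀ := DaveyStewartson.pos_of_mem_quarticConstants hk hC.1
  obtain ⟨V, hV, hqV⟩ := hlim.exists_isTranslatedLimit hT hC.1 hq
  obtain ⟨φ, y, hφ, hyV⟩ := hV.of_comp hσ
  refine ⟨hC, hC₀, Function.extend φ y 0, φ, V, hφ, ?_, ?_⟩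
  · simpa only [hφ.injective.extend_apply] using hyV
  · rw [div_le_iff₀' (by positivity)]
    refine le_of_sq_le_sq ?_ (by positivity)
    calc (m ^ 2) ^ 2 = m ^ 4 := by ring
      _ ≤ sInf (DaveyStewartson.quarticConstants T) * M ^ 2 * ‖DaveyStewartson.toL2 V‖ ^ 2 :=
        hquartic.trans (hqV.trans (by gcongr; exact hg.trans hgrad))
      _ = (M * √(sInf (DaveyStewartson.quarticConstants T)) * ‖DaveyStewartson.toL2 V‖) ^ 2 := by
        rw [mul_pow, mul_pow, Real.sq_sqrt hC₀.le]
        ring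

theorem theorem5 (ν γ : ℝ) (hν : ν = 1 ∨ ν = -1) (hγ : 0 < γ)
    (v : ℕ → DaveyStewartson.H1) (hbdd : ∃ B : ℝ, ∀ n, ‖v n‖ ≤ B)
    (m M : ℝ) (hm : 0 < m) (hM : 0 < M)
    (hgrad : limsup (fun n => ‖DaveyStewartson.grad (v n)‖ ^ 2) atTop ≤ M ^ 2)
    (hquartic : m ^ 4 ≤ limsup (fun n => DaveyStewartson.quartic ν γ (v n)) atTop) :
    -- the optimal constant is attained as a minimum and is positive
    IsLeast (DaveyStewartson.admissibleConstants ν γ) (DaveyStewartson.Copt ν γ) ∧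
    0 < DaveyStewartson.Copt ν γ ∧
    ∃ (x : ℕ → DaveyStewartson.Plane) (φ : ℕ → ℕ) (V : DaveyStewartson.H1), StrictMono φ ∧
      DaveyStewartson.WeaklyConverges (fun k => DaveyStewartson.translate (x (φ k)) (v (φ k))) V ∧
      m ^ 2 / (M * √(DaveyStewartson.Copt ν γ)) ≤ ‖DaveyStewartson.toL2 V‖ := by
  rw [DaveyStewartson.quartic_eq_quarticForm] at hquartic
  rw [DaveyStewartson.Copt, DaveyStewartson.admissibleConstants_eq_quarticConstants]
  exact theorem5_general _ (DaveyStewartson.isTranslationInvariant_opLCLM ν γ) v hbdd m M hm hM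
    hgrad hquartic
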